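/- Let $c\in\mathbb R$, let $D\subseteq\mathbb R^2$ be a nonempty connected open set of points $(x,t)$ and let $J\subseteq\mathbb R$ be an open interval. Call $f:J\to\mathbb R$ nonlinear if it is $C^\infty$ and not of the form $f(u)=au+b$ on $J$. Consider the generalized Boussinesq equation $$\Delta_f\equiv u_{tt}-u_{xxtt}+u_{xxxxtt}+c\,u_{xxxx}-u_{xx}-(f(u))_{xx}=0 .\qquad(\ast)$$ A vector field $V=\xi(x,t,u)\partial_x+\tau(x,t,u)\partial_t+\eta(x,t,u)\partial_u$, smooth on $D\times J$, is a classical Lie point symmetry of $(\ast)$ if $\mathrm{pr}^{(6)}V(\Delta_f)=0$ at every jet over $D\times J$ at which $\Delta_f=0$, where $\mathrm{pr}^{(6)}V$ is the sixth prolongation of $V$. For a smooth vector field $V$ on $D\times J$ and $(\lambda,\mu)\ne(0,0)$, say that $V$ reduces $(\ast)$ to traveling waves with parameters $(\lambda,\mu)$ if for every convex open $U\subseteq D$ and every $C^6$ function $u:U\to J$ the following hold. First, $u$ satisfies the invariant surface condition $\eta(x,t,u)-\xi(x,t,u)u_x-\tau(x,t,u)u_t=0$ on $U$ if and only if $u(x,t)=h(z)$,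 $z=\mu x-\lambda t$, on $U$ for some $C^6$ function $h$ on $Z=\{\mu x-\lambda t:(x,t)\in U\}$. Second, whenever $u=h(\mu x-\lambda t)$ with such an $h$, $u$ solves $(\ast)$ on $U$ if and only if there are constants $A,B\in\mathbb R$ with $$\lambda^2\mu^4h''''+\mu^2(\mu^2c-\lambda^2)h''+(\lambda^2-\mu^2)h-\mu^2f(h)+Az+B=0\quad\text{on } Z.$$ Then: 1. Suppose $c\neq0$ and $f$ is any nonlinear function on $J$. A smooth vector field $V$ on $D\times J$ is a classical Lie point symmetry of $(\ast)$ if and only if there are constants $\lambda,\mu\in\mathbb R$ with $\xi=\lambda$, $\tau=\mu$, $\eta=0$ on $D\times J$; that is, the symmetries are exactly the linear combinations of $\partial_x$ and $\partial_t$. Every such $V$ that is not identically zero has $(\lambda,\mu)\ne(0,0)$ and reduces $(\ast)$ to traveling waves with parameters $(\lambda,\mu)$. 2. For every $c\in\mathbb R$ (including $c=0$), a smooth vector field $V$ on $D\times J$ is a classical Lie point symmetry of $(\ast)$ for all nonlinear $f$ on $J$ simultaneously if and only if $\xi=\lambda$, $\tau=\mu$, $\eta=0$ on $D\times J$ for some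 constants $\lambda,\mu$; if such a $V$ is not identically zero, then $(\lambda,\mu)\neq(0,0)$ and, for every nonlinear $f$ on $J$, $V$ reduces $(\ast)$ to traveling waves with parameters $(\lambda,\mu)$. 3. For all $c\in\mathbb R$ and every nonlinear $f$ on $J$, the translations map solutions to solutions: if $u$ is a $C^6$ solution of $(\ast)$ with values in $J$ on an open set $U\subseteq\mathbb R^2$, then for all $\lambda,\mu,\varepsilon\in\mathbb R$ the function $u(x-\varepsilon\lambda,t-\varepsilon\mu)$ is a $C^6$ solution with values in $J$ on the translated set $U+\varepsilon(\lambda,\mu)$. -/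

import Mathlib

open scoped ContDiff

namespace Boussinesq

/-- The partial derivative `∂u/∂x` of a function `u (x, t)`. -/
noncomputable def Dx (u : ℝ → ℝ → ℝ) : ℝ → ℝ → ℝ := fun x t => deriv (fun s => u s t) x

/-- The partial derivative `∂u/∂t` of a function `u (x, t)`. -/
noncomputable def Dt (u : ℝ → ℝ → ℝ) : ℝ → ℝ → ℝ := fun x t => deriv (fun s => u x s) t

/-- The partial derivative `∂ⁱ⁺ʲu / ∂xⁱ∂tʲ`. -/
noncomputable def pd (i j : ℕ) (u : ℝ → ℝ → ℝ) : ℝ → ℝ → ℝ := Dx^[i] (Dt^[j] u)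

/-- `u` is a (classical, `C⁶`) solution on `U`, with values in the interval `J` on which `f` lives,
of the generalized Boussinesq equation
`u_tt - u_xxtt + u_xxxxtt + c u_xxxx - u_xx = (f(u))_xx`. -/
def IsSolutionOn (c : ℝ) (f : ℝ → ℝ) (J : Set ℝ) (U : Set (ℝ × ℝ)) (u : ℝ → ℝ → ℝ) : Prop :=
  ContDiffOn ℝ 6 (fun p : ℝ × ℝ => u p.1 p.2) U ∧
  ∀ x t, (x, t) ∈ U → u x t ∈ J ∧
    pd 0 2 u x t - pd 2 2 u x t + pd 4 2 u x t + c * pd 4 0 u x t - pd 2 0 u x t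
      = pd 2 0 (fun y s => f (u y s)) x t

/-- The fibre coordinates of a jet: `q i j` is the coordinate `u_{xⁱtʲ}`. -/
abbrev Jet : Type := ℕ → ℕ → ℝ

/-- The jet of the function `u` at the point `(x, t)`. -/
noncomputable def jet (u : ℝ → ℝ → ℝ) (x t : ℝ) : Jet := fun i j => pd i j u x t

/-- The left-hand side minus the right-hand side of the generalized Boussinesq equation, as a
function on jet space; `(f(u))_xx` is `f'(u) u_xx + f''(u) u_x ^ 2` there. -/
noncomputable def delta (c : ℝ) (f : ℝ → ℝ) (q : Jet) : ℝ :=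
  q 0 2 - q 2 2 + q 4 2 + c * q 4 0 - q 2 0
    - (deriv f (q 0 0) * q 2 0 + deriv (deriv f) (q 0 0) * q 1 0 ^ 2)

/-- The equation `delta = 0` on jets is the generalized Boussinesq equation. -/
theorem delta_jet {c : ℝ} {f : ℝ → ℝ} {J : Set ℝ} (hJ : IsOpen J) (hf : ContDiffOn ℝ ∞ f J)
    {u : ℝ → ℝ → ℝ} (hu : ContDiff ℝ ∞ (fun p : ℝ × ℝ => u p.1 p.2)) {x t : ℝ}
    (hx : u x t ∈ J) :
    delta c f (jet u x t) =
      pd 0 2 u x t - pd 2 2 u x t + pd 4 2 u x t + c * pd 4 0 u x t - pd 2 0 u x t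
        - pd 2 0 (fun y s => f (u y s)) x t := by
  have hg : ContDiff ℝ ∞ (fun s => u s t) :=
    hu.comp (contDiff_id.prodMk contDiff_const : ContDiff ℝ ∞ (fun s : ℝ => (s, t)))
  have hg1 : Differentiable ℝ (fun s => u s t) := hg.differentiable (by simp)
  have hg2 : Differentiable ℝ (deriv (fun s => u s t)) :=
    (contDiff_infty_iff_deriv.1 hg).2.differentiable (by simp)
  have hf1 : ∀ v ∈ J, DifferentiableAt ℝ f v := fun v hv =>
    (hf.contDiffAt (hJ.mem_nhds hv)).differentiableAt (by simp)
  have hf2 : ∀ v ∈ J, DifferentiableAt ℝ (deriv f) v := fun v hv =>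
    ((hf.deriv_of_isOpen (m := ∞) hJ (by simp)).contDiffAt (hJ.mem_nhds hv)).differentiableAt
      (by simp)
  have hev : ∀ᶠ y in nhds x, deriv (fun s => f (u s t)) y
      = deriv f (u y t) * deriv (fun s => u s t) y := by
    filter_upwards [hg1.continuous.continuousAt.preimage_mem_nhds (hJ.mem_nhds hx)] with y hy
    exact deriv_comp (h := fun s => u s t) (h₂ := f) y (hf1 _ hy) (hg1 y)
  have hfu : HasDerivAt (fun s => deriv f (u s t))
      (deriv (deriv f) (u x t) * deriv (fun s => u s t) x) x :=
    HasDerivAt.comp (h := fun s => u s t) x (hf2 _ hx).hasDerivAt (hg1 x).hasDerivAt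
  have key : pd 2 0 (fun y s => f (u y s)) x t
      = deriv f (u x t) * pd 2 0 u x t + deriv (deriv f) (u x t) * pd 1 0 u x t ^ 2 := by
    simp only [pd, Function.iterate_succ, Function.iterate_zero, Function.comp, id, Dx]
    rw [Filter.EventuallyEq.deriv_eq hev]
    refine (hfu.mul (hg2 x).hasDerivAt).deriv.trans ?_
    ring
  rw [key]
  simp [delta, jet, pd]

/-- A vector field `ξ ∂x + τ ∂t + η ∂u` on the space of the variables `(x, t, u)`. -/
structure VField where
  ξ : ℝ → ℝ → ℝ → ℝ
  τ : ℝ → ℝ → ℝ → ℝ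
  η : ℝ → ℝ → ℝ → ℝ

/-- The region `D × J` of `(x, t, u)`-space. -/
def region (D : Set (ℝ × ℝ)) (J : Set ℝ) : Set (ℝ × ℝ × ℝ) :=
  {p | (p.1, p.2.1) ∈ D ∧ p.2.2 ∈ J}

/-- The vector field is smooth on `D × J`. -/
def VField.SmoothOn (V : VField) (D : Set (ℝ × ℝ)) (J : Set ℝ) : Prop :=
  ContDiffOn ℝ ∞ (fun p : ℝ × ℝ × ℝ => V.ξ p.1 p.2.1 p.2.2) (region D J) ∧
  ContDiffOn ℝ ∞ (fun p : ℝ × ℝ × ℝ => V.τ p.1 p.2.1 p.2.2) (region D J) ∧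
  ContDiffOn ℝ ∞ (fun p : ℝ × ℝ × ℝ => V.η p.1 p.2.1 p.2.2) (region D J)

/-- The characteristic `η - ξ u_x - τ u_t` of the vector field, evaluated along `u`. -/
noncomputable def VField.characteristic (V : VField) (u : ℝ → ℝ → ℝ) : ℝ → ℝ → ℝ := fun x t =>
  V.η x t (u x t) - V.ξ x t (u x t) * Dx u x t - V.τ x t (u x t) * Dt u x t

/-- The coefficient of `∂/∂u_{xⁱtʲ}` in the prolongation of the vector field, namely
`D_xⁱ D_tʲ (η - ξ u_x - τ u_t) + ξ u_{xⁱ⁺¹tʲ} + τ u_{xⁱtʲ⁺¹}` with total derivatives `D_x`, `D_t`,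
evaluated at the jet of `u` at `(x, t)`. (A total derivative is, along the jets of a function,
the ordinary partial derivative; the value depends on `u` only through its jet of order `i + j`.) -/
noncomputable def VField.prCoeff (V : VField) (u : ℝ → ℝ → ℝ) (x t : ℝ) : Jet := fun i j =>
  pd i j (V.characteristic u) x t
    + V.ξ x t (u x t) * pd (i + 1) j u x t + V.τ x t (u x t) * pd i (j + 1) u x t

/-- The prolonged vector field applied to the function `F` of the jet coordinates, at the jet of
`u` at `(x, t)`: the derivative of `F` in the direction of the prolongation. (`F` does not depend
on `x` and `t` explicitly, so that the components along `∂x` and `∂t` do not contribute.) -/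
noncomputable def VField.prApply (V : VField) (F : Jet → ℝ) (u : ℝ → ℝ → ℝ) (x t : ℝ) : ℝ :=
  deriv (fun ε : ℝ => F (fun i j => jet u x t i j + ε * V.prCoeff u x t i j)) 0

/-- `V` is a classical (infinitesimal) Lie point symmetry, on `D × J`, of the generalized
Boussinesq equation `Δ = 0`: `pr⁽⁶⁾V (Δ) = 0` at all jets over `D × J` with `Δ = 0`. Every jet is
the jet of a smooth function. -/
def VField.IsLieSymmetry (V : VField) (c : ℝ) (f : ℝ → ℝ) (D : Set (ℝ × ℝ)) (J : Set ℝ) : Prop :=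
  ∀ x t, (x, t) ∈ D → ∀ u : ℝ → ℝ → ℝ, ContDiff ℝ ∞ (fun p : ℝ × ℝ => u p.1 p.2) →
    u x t ∈ J → delta c f (jet u x t) = 0 → V.prApply (delta c f) u x t = 0

/-- `V = l ∂x + m ∂t` on `D × J`. -/
def VField.IsTranslation (V : VField) (D : Set (ℝ × ℝ)) (J : Set ℝ) (l m : ℝ) : Prop :=
  ∀ x t u, (x, t) ∈ D → u ∈ J → V.ξ x t u = l ∧ V.τ x t u = m ∧ V.η x t u = 0

/-- `V` is not identically zero on `D × J`. -/
def VField.Nontrivial (V : VField) (D : Set (ℝ × ℝ)) (J : Set ℝ) : Prop :=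
  ∃ x t u, (x, t) ∈ D ∧ u ∈ J ∧ (V.ξ x t u ≠ 0 ∨ V.τ x t u ≠ 0 ∨ V.η x t u ≠ 0)

/-- `u` satisfies the invariant surface condition `η - ξ u_x - τ u_t = 0` on `U`. -/
def VField.InvariantSurface (V : VField) (U : Set (ℝ × ℝ)) (u : ℝ → ℝ → ℝ) : Prop :=
  ∀ x t, (x, t) ∈ U → V.characteristic u x t = 0

/-- `f` is a smooth function on `J` that is not of the form `f(u) = a u + b`. -/
def IsNonlinear (f : ℝ → ℝ) (J : Set ℝ) : Prop :=
  ContDiffOn ℝ ∞ f J ∧ ¬ ∃ a b : ℝ, ∀ v ∈ J, f v = a * v + b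

/-- The range of the similarity variable `z = m x - l t` over `U`. -/
def zRange (l m : ℝ) (U : Set (ℝ × ℝ)) : Set ℝ := (fun p : ℝ × ℝ => m * p.1 - l * p.2) '' U

/-- `u (x, t) = h (m x - l t)` on `U`, with a `C⁶` profile `h`. -/
def IsTravelingWave (l m : ℝ) (U : Set (ℝ × ℝ)) (u : ℝ → ℝ → ℝ) (h : ℝ → ℝ) : Prop :=
  ContDiffOn ℝ 6 h (zRange l m U) ∧ ∀ x t, (x, t) ∈ U → u x t = h (m * x - l * t)

/-- The profile equation
`l²m⁴ h'''' + m²(m²c - l²) h'' + (l² - m²) h - m² f(h) + A z + B = 0` on `Z`. -/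
def ProfileODE (c : ℝ) (f : ℝ → ℝ) (l m A B : ℝ) (Z : Set ℝ) (h : ℝ → ℝ) : Prop :=
  ∀ z ∈ Z, l ^ 2 * m ^ 4 * iteratedDeriv 4 h z + m ^ 2 * (m ^ 2 * c - l ^ 2) * iteratedDeriv 2 h z
    + (l ^ 2 - m ^ 2) * h z - m ^ 2 * f (h z) + A * z + B = 0

/-- The symmetry reduction by `V` is the traveling-wave reduction `z = m x - l t`, `u = h(z)`: on
every convex open `U ⊆ D`, the `V`-invariant functions are exactly the traveling waves, and these
solve the generalized Boussinesq equation iff the profile solves the profile equation for some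
constants `A`, `B`. -/
def VField.ReducesToTravelingWave (V : VField) (c : ℝ) (f : ℝ → ℝ) (D : Set (ℝ × ℝ)) (J : Set ℝ)
    (l m : ℝ) : Prop :=
  ∀ U : Set (ℝ × ℝ), IsOpen U → Convex ℝ U → U ⊆ D →
    ∀ u : ℝ → ℝ → ℝ, ContDiffOn ℝ 6 (fun p : ℝ × ℝ => u p.1 p.2) U →
      (∀ x t, (x, t) ∈ U → u x t ∈ J) →
      (V.InvariantSurface U u ↔ ∃ h : ℝ → ℝ, IsTravelingWave l m U u h) ∧
      ∀ h : ℝ → ℝ, IsTravelingWave l m U u h →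
        (IsSolutionOn c f J U u ↔ ∃ A B : ℝ, ProfileODE c f l m A B (zRange l m U) h)

end Boussinesq

namespace Boussinesq

/-! ### Iterated partial derivatives -/

/-! The invariance criterion is an identity on the hypersurface Δ = 0 of jet space. Solving Δ = 0
for u_xxxxtt leaves every other jet coordinate free, so the coefficient of each monomial in those
coordinates must vanish. The criterion involves only x-derivatives of the characteristic Q and of
Q_tt, on a line t = t₀. It is therefore enough to test on functions cubic in t: Q contains u_t, so
Q_tt reaches u_ttt and no further. With polynomial coefficients in x, everything reduces to Leibniz
expansions at one point (`determining_taylor`).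

Comparing the criterion at two jets that differ in one top-order coordinate gives, from u_xxxttt, τ
= τ(t) (`dX_τ_add`); from u_xxxxxt, ξ = ξ(x) (`dT_ξ_add`); from u_xxxtt, η_uu = 0 and 2η_xu = 3ξ_xx
(`dX_dU_η_add`). Once η is affine in u, the criterion is an explicit polynomial in the remaining
coordinates (`determining_affine`). Its u_xxtt and u_tt coefficients are two linear ODEs for ξ whose
only common solutions have ξ_x = 0. The part odd in u_x gives f''η_x = 0, hence η_x = 0, as η_x does
not depend on u and f'' is nonzero somewhere. The zero jet then gives η_tt = 0. The u_xxxx and u_xx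
coefficients are the classifying equations c τ_t = 0 and 2τ_t(1 + f') + f''η = 0 (`classifying`).

If c ≠ 0, then τ_t = 0 and f''η = 0; since η is affine in u and vanishes on a nonempty open set of
u, it is zero. If the symmetry is shared by all nonlinear f, the classifying equations of u² and 2u²
already force τ_t = η = 0. Conversely, for a translation the prolongation coefficients vanish
identically because partial derivatives commute.

For the reduction, l u_x + m u_t = 0 on a convex set makes u constant along the chords on which m x
- l t is constant, so u = h(m x - l t) (`exists_isTravelingWave`). For such u the equation is
exactly the second derivative of the profile expression, and integrating twice over an interval
produces A z + B (`isSolutionOn_wave_iff`). -/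

theorem Dx_iterate (i : ℕ) (g : ℝ → ℝ → ℝ) (x t : ℝ) :
    Dx^[i] g x t = iteratedDeriv i (fun s => g s t) x := by
  induction i generalizing x with
  | zero => simp
  | succ i ih =>
    rw [Function.iterate_succ_apply', iteratedDeriv_succ]
    exact congrArg (fun w => deriv w x) (funext fun s => ih s)

theorem Dt_iterate (j : ℕ) (g : ℝ → ℝ → ℝ) (x t : ℝ) :
    Dt^[j] g x t = iteratedDeriv j (g x) t := by
  induction j generalizing t with
  | zero => simp
  | succ j ih =>
    rw [Function.iterate_succ_apply', iteratedDeriv_succ]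
    exact congrArg (fun w => deriv w t) (funext fun s => ih s)

theorem pd_eq_iteratedDeriv (i j : ℕ) (g : ℝ → ℝ → ℝ) (x t : ℝ) :
    pd i j g x t = iteratedDeriv i (fun s => iteratedDeriv j (g s) t) x := by
  rw [pd, Dx_iterate]
  exact congrArg (fun w => iteratedDeriv i w x) (funext fun s => Dt_iterate j g s t)

/-! ### Smooth functions of the three variables `(x, t, u)` -/

/-- `F (x, t, u)` is smooth on the set `R`. -/
def Smooth (R : Set (ℝ × ℝ × ℝ)) (F : ℝ → ℝ → ℝ → ℝ) : Prop :=
  ContDiffOn ℝ ∞ (fun p : ℝ × ℝ × ℝ => F p.1 p.2.1 p.2.2) R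

/-- The partial derivative `∂F/∂x` of `F (x, t, u)`. -/
noncomputable def dX (F : ℝ → ℝ → ℝ → ℝ) : ℝ → ℝ → ℝ → ℝ := fun x t u => deriv (fun s => F s t u) x

/-- The partial derivative `∂F/∂t` of `F (x, t, u)`. -/
noncomputable def dT (F : ℝ → ℝ → ℝ → ℝ) : ℝ → ℝ → ℝ → ℝ := fun x t u => deriv (fun s => F x s u) t

/-- The partial derivative `∂F/∂u` of `F (x, t, u)`. -/
noncomputable def dU (F : ℝ → ℝ → ℝ → ℝ) : ℝ → ℝ → ℝ → ℝ := fun x t u => deriv (fun s => F x t s) u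

section

variable {R : Set (ℝ × ℝ × ℝ)} {F : ℝ → ℝ → ℝ → ℝ}

theorem Smooth.contDiffAt_comp (hF : Smooth R F) (hR : IsOpen R) {a b v : ℝ → ℝ} {s : ℝ}
    (h : (a s, b s, v s) ∈ R) (ha : ContDiffAt ℝ ∞ a s) (hb : ContDiffAt ℝ ∞ b s)
    (hv : ContDiffAt ℝ ∞ v s) : ContDiffAt ℝ ∞ (fun s => F (a s) (b s) (v s)) s :=
  ContDiffAt.comp (f := fun s => (a s, b s, v s))
    (g := fun p : ℝ × ℝ × ℝ => F p.1 p.2.1 p.2.2) s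
    (hF.contDiffAt (hR.mem_nhds h)) (ha.prodMk (hb.prodMk hv))

theorem Smooth.hasDerivAt_comp_fderiv (hF : Smooth R F) (hR : IsOpen R) {a b v : ℝ → ℝ}
    {s a' b' v' : ℝ} (h : (a s, b s, v s) ∈ R) (ha : HasDerivAt a a' s) (hb : HasDerivAt b b' s)
    (hv : HasDerivAt v v' s) :
    HasDerivAt (fun s => F (a s) (b s) (v s))
      (fderiv ℝ (fun p : ℝ × ℝ × ℝ => F p.1 p.2.1 p.2.2) (a s, b s, v s) (a', b', v')) s :=
  HasFDerivAt.comp_hasDerivAt (f := fun s => (a s, b s, v s))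
    (l := fun p : ℝ × ℝ × ℝ => F p.1 p.2.1 p.2.2) s
    ((hF.contDiffAt (hR.mem_nhds h)).differentiableAt (by simp)).hasFDerivAt
    (ha.prodMk (hb.prodMk hv))

/-- Writing the coordinate derivatives as values of one Fréchet derivative is what makes them smooth
again and makes mixed partials commute. -/
theorem Smooth.dX_eq (hF : Smooth R F) (hR : IsOpen R) {x t u : ℝ} (h : (x, t, u) ∈ R) :
    dX F x t u = fderiv ℝ (fun p : ℝ × ℝ × ℝ => F p.1 p.2.1 p.2.2) (x, t, u) (1, 0, 0) :=
  (hF.hasDerivAt_comp_fderiv hR (a := id) (b := fun _ => t) (v := fun _ => u) h (hasDerivAt_id x)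
    (hasDerivAt_const x t) (hasDerivAt_const x u)).deriv

theorem Smooth.dT_eq (hF : Smooth R F) (hR : IsOpen R) {x t u : ℝ} (h : (x, t, u) ∈ R) :
    dT F x t u = fderiv ℝ (fun p : ℝ × ℝ × ℝ => F p.1 p.2.1 p.2.2) (x, t, u) (0, 1, 0) :=
  (hF.hasDerivAt_comp_fderiv hR (a := fun _ => x) (b := id) (v := fun _ => u) h
    (hasDerivAt_const t x) (hasDerivAt_id t) (hasDerivAt_const t u)).deriv

theorem Smooth.dU_eq (hF : Smooth R F) (hR : IsOpen R) {x t u : ℝ} (h : (x, t, u) ∈ R) :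
    dU F x t u = fderiv ℝ (fun p : ℝ × ℝ × ℝ => F p.1 p.2.1 p.2.2) (x, t, u) (0, 0, 1) :=
  (hF.hasDerivAt_comp_fderiv hR (a := fun _ => x) (b := fun _ => t) (v := id) h
    (hasDerivAt_const u x) (hasDerivAt_const u t) (hasDerivAt_id u)).deriv

theorem Smooth.fderiv_apply (hF : Smooth R F) (hR : IsOpen R) (w : ℝ × ℝ × ℝ) :
    ContDiffOn ℝ ∞ (fun p => fderiv ℝ (fun p : ℝ × ℝ × ℝ => F p.1 p.2.1 p.2.2) p w) R :=
  (ContDiffOn.fderiv_of_isOpen hF hR (m := ∞) (by simp)).clm_apply contDiffOn_const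

theorem Smooth.smooth_dX (hF : Smooth R F) (hR : IsOpen R) : Smooth R (dX F) :=
  (hF.fderiv_apply hR _).congr fun _ h => hF.dX_eq hR h

theorem Smooth.smooth_dT (hF : Smooth R F) (hR : IsOpen R) : Smooth R (dT F) :=
  (hF.fderiv_apply hR _).congr fun _ h => hF.dT_eq hR h

theorem Smooth.smooth_dU (hF : Smooth R F) (hR : IsOpen R) : Smooth R (dU F) :=
  (hF.fderiv_apply hR _).congr fun _ h => hF.dU_eq hR h

theorem Smooth.hasDerivAt_comp (hF : Smooth R F) (hR : IsOpen R) {a b v : ℝ → ℝ}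
    {s a' b' v' : ℝ} (h : (a s, b s, v s) ∈ R) (ha : HasDerivAt a a' s) (hb : HasDerivAt b b' s)
    (hv : HasDerivAt v v' s) :
    HasDerivAt (fun s => F (a s) (b s) (v s))
      (dX F (a s) (b s) (v s) * a' + dT F (a s) (b s) (v s) * b' + dU F (a s) (b s) (v s) * v')
      s := by
  convert hF.hasDerivAt_comp_fderiv hR h ha hb hv using 1
  rw [hF.dX_eq hR h, hF.dT_eq hR h, hF.dU_eq hR h]
  have : ((a', b', v') : ℝ × ℝ × ℝ)
      = a' • ((1, 0, 0) : ℝ × ℝ × ℝ) + b' • ((0, 1, 0) : ℝ × ℝ × ℝ)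
        + v' • ((0, 0, 1) : ℝ × ℝ × ℝ) := by simp
  rw [this]
  simp only [map_add, map_smul, smul_eq_mul]
  ring

/-- The chain rule along a curve `t ↦ (x, t, v t)`. -/
theorem Smooth.hasDerivAt_t (hF : Smooth R F) (hR : IsOpen R) {v : ℝ → ℝ} {x t v' : ℝ}
    (h : (x, t, v t) ∈ R) (hv : HasDerivAt v v' t) :
    HasDerivAt (fun t => F x t (v t)) (dT F x t (v t) + dU F x t (v t) * v') t := by
  simpa using hF.hasDerivAt_comp hR (a := fun _ => x) (b := id) h (hasDerivAt_const t x)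
    (hasDerivAt_id t) hv

/-- The chain rule along a curve `x ↦ (x, t, v x)`. -/
theorem Smooth.hasDerivAt_x (hF : Smooth R F) (hR : IsOpen R) {v : ℝ → ℝ} {x t v' : ℝ}
    (h : (x, t, v x) ∈ R) (hv : HasDerivAt v v' x) :
    HasDerivAt (fun x => F x t (v x)) (dX F x t (v x) + dU F x t (v x) * v') x := by
  simpa using hF.hasDerivAt_comp hR (a := id) (b := fun _ => t) h (hasDerivAt_id x)
    (hasDerivAt_const x t) hv

/-- `D_t (F (x, t, u))` where `u_t = v'`. -/
noncomputable def dt₁ (F : ℝ → ℝ → ℝ → ℝ) (x t v v' : ℝ) : ℝ := dT F x t v + dU F x t v * v'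

/-- `D_t² (F (x, t, u))` where `u_t = v'`, `u_tt = v''`. -/
noncomputable def dt₂ (F : ℝ → ℝ → ℝ → ℝ) (x t v v' v'' : ℝ) : ℝ :=
  dT (dT F) x t v + (dU (dT F) x t v + dT (dU F) x t v) * v' + dU (dU F) x t v * v' ^ 2
    + dU F x t v * v''

theorem Smooth.iteratedDeriv_one_t (hF : Smooth R F) (hR : IsOpen R) {v : ℝ → ℝ} {x t : ℝ}
    (h : (x, t, v t) ∈ R) (hv : ContDiff ℝ ∞ v) :
    iteratedDeriv 1 (fun t => F x t (v t)) t = dt₁ F x t (v t) (iteratedDeriv 1 v t) := by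
  rw [iteratedDeriv_one, iteratedDeriv_one]
  exact (hF.hasDerivAt_t hR h (hv.differentiable (by simp) t).hasDerivAt).deriv

theorem Smooth.iteratedDeriv_two_t (hF : Smooth R F) (hR : IsOpen R) {v : ℝ → ℝ} {x t : ℝ}
    (h : (x, t, v t) ∈ R) (hv : ContDiff ℝ ∞ v) :
    iteratedDeriv 2 (fun t => F x t (v t)) t
      = dt₂ F x t (v t) (iteratedDeriv 1 v t) (iteratedDeriv 2 v t) := by
  have hc : Continuous (fun t => (x, t, v t)) := by
    have := hv.continuous
    fun_prop
  have hev : ∀ᶠ s in nhds t, iteratedDeriv 1 (fun t => F x t (v t)) s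
      = dT F x s (v s) + dU F x s (v s) * deriv v s := by
    filter_upwards [hc.continuousAt.preimage_mem_nhds (hR.mem_nhds h)] with s hs
    rw [hF.iteratedDeriv_one_t hR hs hv, iteratedDeriv_one, dt₁]
  rw [iteratedDeriv_succ, Filter.EventuallyEq.deriv_eq hev]
  have hd : HasDerivAt v (deriv v t) t := (hv.differentiable (by simp) t).hasDerivAt
  have hdd : HasDerivAt (deriv v) (deriv (deriv v) t) t :=
    ((contDiff_infty_iff_deriv.1 hv).2.differentiable (by simp) t).hasDerivAt
  refine (((hF.smooth_dT hR).hasDerivAt_t hR h hd).add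
    (((hF.smooth_dU hR).hasDerivAt_t hR h hd).mul hdd)).deriv.trans ?_
  rw [iteratedDeriv_succ (n := 1), iteratedDeriv_one, dt₂]
  ring

end

/-! ### Test functions that are cubic in `t` -/

/-- The function `p(x) + q(x)(t-t₀) + r(x)(t-t₀)²/2 + z(x)(t-t₀)³/6`. -/
noncomputable def cubic (t₀ : ℝ) (p q r z : ℝ → ℝ) : ℝ → ℝ → ℝ := fun x t =>
  p x + q x * (t - t₀) + r x * ((t - t₀) ^ 2 / 2) + z x * ((t - t₀) ^ 3 / 6)

section

variable {t₀ : ℝ} {p q r z : ℝ → ℝ}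

theorem contDiff_cubic (hp : ContDiff ℝ ∞ p) (hq : ContDiff ℝ ∞ q) (hr : ContDiff ℝ ∞ r)
    (hz : ContDiff ℝ ∞ z) : ContDiff ℝ ∞ (fun y : ℝ × ℝ => cubic t₀ p q r z y.1 y.2) := by
  unfold cubic
  fun_prop

theorem cubic_self (x : ℝ) : cubic t₀ p q r z x t₀ = p x := by simp [cubic]

theorem contDiff_cubic_t (x : ℝ) : ContDiff ℝ ∞ (cubic t₀ p q r z x) := by
  unfold cubic
  fun_prop

/-- The factorial normalization turns ∂/∂t into a shift of the coefficient functions, so on t = t₀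
the t-derivatives of orders 0 to 3 are p, q, r, z. -/
theorem Dt_cubic : Dt (cubic t₀ p q r z) = cubic t₀ q r z 0 := by
  funext x t
  have h : HasDerivAt (fun t => t - t₀) 1 t := (hasDerivAt_id t).sub_const t₀
  refine HasDerivAt.deriv (HasDerivAt.congr_deriv (((h.const_mul (q x)).const_add (p x)).add
    (((h.pow 2).div_const 2).const_mul (r x)) |>.add (((h.pow 3).div_const 6).const_mul (z x))) ?_)
  simp only [cubic, Pi.zero_apply]
  push_cast
  ring

theorem Dx_cubic (hp : ContDiff ℝ ∞ p) (hq : ContDiff ℝ ∞ q) (hr : ContDiff ℝ ∞ r)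
    (hz : ContDiff ℝ ∞ z) :
    Dx (cubic t₀ p q r z) = cubic t₀ (deriv p) (deriv q) (deriv r) (deriv z) := by
  funext x t
  have h : ∀ {g : ℝ → ℝ}, ContDiff ℝ ∞ g → HasDerivAt g (deriv g x) x := fun hg =>
    (hg.differentiable (by simp) x).hasDerivAt
  exact ((((h hp).add ((h hq).mul_const _)).add ((h hr).mul_const _)).add
    ((h hz).mul_const _)).deriv

theorem iteratedDeriv_cubic_one (x : ℝ) : iteratedDeriv 1 (cubic t₀ p q r z x) t₀ = q x := by
  have := Dt_iterate 1 (cubic t₀ p q r z) x t₀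
  rw [← this, Function.iterate_one, Dt_cubic, cubic_self]

theorem iteratedDeriv_cubic_two (x : ℝ) : iteratedDeriv 2 (cubic t₀ p q r z x) t₀ = r x := by
  rw [← Dt_iterate 2 (cubic t₀ p q r z) x t₀]
  simp [Dt_cubic, cubic_self]

theorem pd_cubic_zero (i : ℕ) (x : ℝ) : pd i 0 (cubic t₀ p q r z) x t₀ = iteratedDeriv i p x := by
  simp [pd, Dx_iterate, cubic_self]

theorem pd_cubic_one (i : ℕ) (x : ℝ) : pd i 1 (cubic t₀ p q r z) x t₀ = iteratedDeriv i q x := by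
  simp [pd, Dx_iterate, Dt_cubic, cubic_self]

theorem pd_cubic_two (i : ℕ) (x : ℝ) : pd i 2 (cubic t₀ p q r z) x t₀ = iteratedDeriv i r x := by
  simp [pd, Dx_iterate, Dt_cubic, cubic_self]

theorem pd_cubic_three (i : ℕ) (x : ℝ) : pd i 3 (cubic t₀ p q r z) x t₀ = iteratedDeriv i z x := by
  simp [pd, Dx_iterate, Dt_cubic, cubic_self]

end

/-! ### The determining equation along a test function -/

/-- Chain rule for Δ in its finitely many jet coordinates; membership in `J` is what makes f' and
f'' differentiable at the base point. -/
theorem prApply_delta {V : VField} {c : ℝ} {f : ℝ → ℝ} {J : Set ℝ} (hJ : IsOpen J)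
    (hf : ContDiffOn ℝ ∞ f J) {u : ℝ → ℝ → ℝ} {x t : ℝ} (hx : u x t ∈ J) :
    V.prApply (delta c f) u x t =
      V.prCoeff u x t 0 2 - V.prCoeff u x t 2 2 + V.prCoeff u x t 4 2 + c * V.prCoeff u x t 4 0
        - (1 + deriv f (u x t)) * V.prCoeff u x t 2 0
        - deriv (deriv f) (u x t) * V.prCoeff u x t 0 0 * pd 2 0 u x t
        - 2 * deriv (deriv f) (u x t) * pd 1 0 u x t * V.prCoeff u x t 1 0
        - deriv (deriv (deriv f)) (u x t) * V.prCoeff u x t 0 0 * pd 1 0 u x t ^ 2 := by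
  have hf1 : ContDiffOn ℝ ∞ (deriv f) J := hf.deriv_of_isOpen hJ (by simp)
  have hf2 : ContDiffOn ℝ ∞ (deriv (deriv f)) J := hf1.deriv_of_isOpen hJ (by simp)
  have hd : ∀ {g : ℝ → ℝ}, ContDiffOn ℝ ∞ g J → HasDerivAt g (deriv g (u x t)) (u x t) :=
    fun hg => ((hg.contDiffAt (hJ.mem_nhds hx)).differentiableAt (by simp)).hasDerivAt
  have hl : ∀ i j, HasDerivAt (fun ε : ℝ => jet u x t i j + ε * V.prCoeff u x t i j)
      (V.prCoeff u x t i j) 0 := fun i j => by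
    simpa using ((hasDerivAt_id (0 : ℝ)).mul_const (V.prCoeff u x t i j)).const_add (jet u x t i j)
  have h00 : jet u x t 0 0 + 0 * V.prCoeff u x t 0 0 = u x t := by simp [jet, pd]
  have hc : ∀ {g : ℝ → ℝ}, ContDiffOn ℝ ∞ g J →
      HasDerivAt (fun ε : ℝ => g (jet u x t 0 0 + ε * V.prCoeff u x t 0 0))
        (deriv g (u x t) * V.prCoeff u x t 0 0) 0 := fun {g} hg => by
    have h := hd hg
    rw [← h00] at h
    have h2 := HasDerivAt.comp (0 : ℝ) h (hl 0 0)
    rw [h00] at h2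
    exact h2
  have main := (((((hl 0 2).sub (hl 2 2)).add (hl 4 2)).add ((hl 4 0).const_mul c)).sub
    (hl 2 0)).sub (((hc hf1).mul (hl 2 0)).add ((hc hf2).mul ((hl 1 0).pow 2)))
  refine main.deriv.trans ?_
  rw [h00]
  simp only [zero_mul, add_zero, jet, Pi.pow_apply]
  push_cast
  ring

/-- The characteristic on the line `t = t₀`, along a test function. -/
noncomputable def VField.char₀ (V : VField) (t₀ : ℝ) (p q : ℝ → ℝ) : ℝ → ℝ := fun x =>
  V.η x t₀ (p x) - V.ξ x t₀ (p x) * deriv p x - V.τ x t₀ (p x) * q x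

/-- The second `t`-derivative of the characteristic on the line `t = t₀`, along a test function. -/
noncomputable def VField.char₂ (V : VField) (t₀ : ℝ) (p q r z : ℝ → ℝ) : ℝ → ℝ := fun x =>
  dt₂ V.η x t₀ (p x) (q x) (r x)
    - (dt₂ V.ξ x t₀ (p x) (q x) (r x) * deriv p x + 2 * dt₁ V.ξ x t₀ (p x) (q x) * deriv q x
        + V.ξ x t₀ (p x) * deriv r x)
    - (dt₂ V.τ x t₀ (p x) (q x) (r x) * q x + 2 * dt₁ V.τ x t₀ (p x) (q x) * r x
        + V.τ x t₀ (p x) * z x)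

theorem isOpen_region {D : Set (ℝ × ℝ)} {J : Set ℝ} (hD : IsOpen D) (hJ : IsOpen J) :
    IsOpen (region D J) :=
  (hD.preimage (by fun_prop : Continuous fun p : ℝ × ℝ × ℝ => (p.1, p.2.1))).inter
    (hJ.preimage (by fun_prop : Continuous fun p : ℝ × ℝ × ℝ => p.2.2))

section

variable {V : VField} {D : Set (ℝ × ℝ)} {J : Set ℝ} {t₀ : ℝ} {p q r z : ℝ → ℝ}

theorem characteristic_cubic_zero (hp : ContDiff ℝ ∞ p) (hq : ContDiff ℝ ∞ q)
    (hr : ContDiff ℝ ∞ r) (hz : ContDiff ℝ ∞ z) (x : ℝ) :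
    V.characteristic (cubic t₀ p q r z) x t₀ = V.char₀ t₀ p q x := by
  simp [VField.characteristic, VField.char₀, Dx_cubic hp hq hr hz, Dt_cubic, cubic_self]

theorem iteratedDeriv_two_fun_mul {A B : ℝ → ℝ} {t : ℝ} (hA : ContDiffAt ℝ ∞ A t)
    (hB : ContDiffAt ℝ ∞ B t) : iteratedDeriv 2 (fun t => A t * B t) t =
      iteratedDeriv 2 A t * B t + 2 * iteratedDeriv 1 A t * iteratedDeriv 1 B t
        + A t * iteratedDeriv 2 B t := by
  have e : ((2 : ℕ) : WithTop ℕ∞) ≤ ∞ := ENat.LEInfty.out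
  rw [iteratedDeriv_fun_mul (hA.of_le e) (hB.of_le e)]
  simp [Finset.sum_range_succ]
  ring

theorem characteristic_cubic_two (hV : V.SmoothOn D J) (hD : IsOpen D) (hJ : IsOpen J)
    (hp : ContDiff ℝ ∞ p) (hq : ContDiff ℝ ∞ q) (hr : ContDiff ℝ ∞ r) (hz : ContDiff ℝ ∞ z)
    {x : ℝ} (hx : (x, t₀, p x) ∈ region D J) :
    iteratedDeriv 2 (V.characteristic (cubic t₀ p q r z) x) t₀ = V.char₂ t₀ p q r z x := by
  have hR := isOpen_region hD hJ
  have hx' : (x, t₀, cubic t₀ p q r z x t₀) ∈ region D J := by rwa [cubic_self]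
  have hs : ∀ {F}, Smooth (region D J) F →
      ContDiffAt ℝ ∞ (fun t => F x t (cubic t₀ p q r z x t)) t₀ := fun hF =>
    hF.contDiffAt_comp hR (a := fun _ => x) (b := id) hx' contDiffAt_const contDiffAt_id
      (contDiff_cubic_t x).contDiffAt
  have e : ((2 : ℕ) : WithTop ℕ∞) ≤ ∞ := ENat.LEInfty.out
  have hmul : ∀ {F} {p' q' r' z' : ℝ → ℝ}, Smooth (region D J) F →
      ContDiffAt ℝ ∞ (fun t => F x t (cubic t₀ p q r z x t) * cubic t₀ p' q' r' z' x t) t₀ :=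
    fun hF => (hs hF).mul (contDiff_cubic_t x).contDiffAt
  have hfun : V.characteristic (cubic t₀ p q r z) x = fun t =>
      V.η x t (cubic t₀ p q r z x t)
        - V.ξ x t (cubic t₀ p q r z x t) * cubic t₀ (deriv p) (deriv q) (deriv r) (deriv z) x t
        - V.τ x t (cubic t₀ p q r z x t) * cubic t₀ q r z 0 x t := by
    funext t
    simp only [VField.characteristic, Dx_cubic hp hq hr hz, Dt_cubic]
  rw [hfun, iteratedDeriv_fun_sub (((hs hV.2.2).sub (hmul hV.1)).of_le e) ((hmul hV.2.1).of_le e),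
    iteratedDeriv_fun_sub ((hs hV.2.2).of_le e) ((hmul hV.1).of_le e),
    iteratedDeriv_two_fun_mul (hs hV.1) (contDiff_cubic_t x).contDiffAt,
    iteratedDeriv_two_fun_mul (hs hV.2.1) (contDiff_cubic_t x).contDiffAt]
  simp only [Smooth.iteratedDeriv_two_t hV.1 hR hx' (contDiff_cubic_t x),
    Smooth.iteratedDeriv_two_t hV.2.1 hR hx' (contDiff_cubic_t x),
    Smooth.iteratedDeriv_two_t hV.2.2 hR hx' (contDiff_cubic_t x),
    Smooth.iteratedDeriv_one_t hV.1 hR hx' (contDiff_cubic_t x),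
    Smooth.iteratedDeriv_one_t hV.2.1 hR hx' (contDiff_cubic_t x),
    iteratedDeriv_cubic_one, iteratedDeriv_cubic_two, cubic_self, VField.char₂]

theorem prCoeff_cubic_zero (hp : ContDiff ℝ ∞ p) (hq : ContDiff ℝ ∞ q)
    (hr : ContDiff ℝ ∞ r) (hz : ContDiff ℝ ∞ z) (i : ℕ) (x : ℝ) :
    V.prCoeff (cubic t₀ p q r z) x t₀ i 0 = iteratedDeriv i (V.char₀ t₀ p q) x
      + V.ξ x t₀ (p x) * iteratedDeriv (i + 1) p x + V.τ x t₀ (p x) * iteratedDeriv i q x := by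
  rw [VField.prCoeff, pd_cubic_zero, pd_cubic_one, cubic_self, pd_eq_iteratedDeriv]
  simp only [iteratedDeriv_zero, characteristic_cubic_zero hp hq hr hz]

theorem prCoeff_cubic_two (hV : V.SmoothOn D J) (hD : IsOpen D) (hJ : IsOpen J)
    (hp : ContDiff ℝ ∞ p) (hq : ContDiff ℝ ∞ q) (hr : ContDiff ℝ ∞ r) (hz : ContDiff ℝ ∞ z)
    (i : ℕ) {x : ℝ} (hx : (x, t₀, p x) ∈ region D J) :
    V.prCoeff (cubic t₀ p q r z) x t₀ i 2 = iteratedDeriv i (V.char₂ t₀ p q r z) x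
      + V.ξ x t₀ (p x) * iteratedDeriv (i + 1) r x + V.τ x t₀ (p x) * iteratedDeriv i z x := by
  rw [VField.prCoeff, pd_cubic_two, pd_cubic_three, cubic_self, pd_eq_iteratedDeriv]
  congr 2
  have hc : Continuous (fun x => (x, t₀, p x)) := by
    have := hp.continuous
    fun_prop
  -- The formula for the second t-derivative is available only where the curve (y, t₀, p y) stays in
  -- the region; that is a neighbourhood of x, which suffices for x-derivatives at x.
  refine Filter.EventuallyEq.iteratedDeriv_eq i ?_
  filter_upwards [hc.continuousAt.preimage_mem_nhds ((isOpen_region hD hJ).mem_nhds hx)] with y hy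
  exact characteristic_cubic_two hV hD hJ hp hq hr hz hy

/-- The infinitesimal invariance criterion along a test function. -/
theorem VField.IsLieSymmetry.determining {c : ℝ} {f : ℝ → ℝ} (h : V.IsLieSymmetry c f D J)
    (hV : V.SmoothOn D J) (hD : IsOpen D) (hJ : IsOpen J) (hf : ContDiffOn ℝ ∞ f J)
    (hp : ContDiff ℝ ∞ p) (hq : ContDiff ℝ ∞ q) (hr : ContDiff ℝ ∞ r) (hz : ContDiff ℝ ∞ z)
    {x v : ℝ} (hx : (x, t₀) ∈ D) (hv : v ∈ J) (hpv : p x = v)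
    (hΔ : r x - iteratedDeriv 2 r x + iteratedDeriv 4 r x + c * iteratedDeriv 4 p x
      - iteratedDeriv 2 p x - (deriv f v * iteratedDeriv 2 p x
        + deriv (deriv f) v * iteratedDeriv 1 p x ^ 2) = 0) :
    (V.char₂ t₀ p q r z x + V.ξ x t₀ v * iteratedDeriv 1 r x + V.τ x t₀ v * z x)
      - (iteratedDeriv 2 (V.char₂ t₀ p q r z) x + V.ξ x t₀ v * iteratedDeriv 3 r x
        + V.τ x t₀ v * iteratedDeriv 2 z x)
      + (iteratedDeriv 4 (V.char₂ t₀ p q r z) x + V.ξ x t₀ v * iteratedDeriv 5 r x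
        + V.τ x t₀ v * iteratedDeriv 4 z x)
      + c * (iteratedDeriv 4 (V.char₀ t₀ p q) x + V.ξ x t₀ v * iteratedDeriv 5 p x
        + V.τ x t₀ v * iteratedDeriv 4 q x)
      - (1 + deriv f v) * (iteratedDeriv 2 (V.char₀ t₀ p q) x + V.ξ x t₀ v * iteratedDeriv 3 p x
        + V.τ x t₀ v * iteratedDeriv 2 q x)
      - deriv (deriv f) v * V.η x t₀ v * iteratedDeriv 2 p x
      - 2 * deriv (deriv f) v * iteratedDeriv 1 p x * (iteratedDeriv 1 (V.char₀ t₀ p q) x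
        + V.ξ x t₀ v * iteratedDeriv 2 p x + V.τ x t₀ v * iteratedDeriv 1 q x)
      - deriv (deriv (deriv f)) v * V.η x t₀ v * iteratedDeriv 1 p x ^ 2 = 0 := by
  subst hpv
  have hxR : (x, t₀, p x) ∈ region D J := ⟨hx, hv⟩
  have hu : cubic t₀ p q r z x t₀ ∈ J := by rwa [cubic_self]
  have key := h x t₀ hx (cubic t₀ p q r z) (contDiff_cubic hp hq hr hz) hu (by
    simpa only [delta, jet, pd_cubic_zero, pd_cubic_two, iteratedDeriv_zero] using hΔ)
  rw [prApply_delta hJ hf hu] at key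
  simp only [prCoeff_cubic_zero hp hq hr hz, prCoeff_cubic_two hV hD hJ hp hq hr hz _ hxR,
    pd_cubic_zero, cubic_self, iteratedDeriv_zero] at key
  rw [← key]
  simp only [zero_add, Nat.reduceAdd, iteratedDeriv_one]
  -- The undifferentiated prolongation coefficient is η itself: the terms ξ u_x and τ u_t added back
  -- cancel those in the characteristic.
  rw [show V.char₀ t₀ p q x = V.η x t₀ (p x) - V.ξ x t₀ (p x) * deriv p x - V.τ x t₀ (p x) * q x
    from rfl]
  ring

end

/-! ### Polynomials given by their Taylor coefficients -/

/-- The polynomial with Taylor coefficients `a₀, …, a₅` at `x₀`. -/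
noncomputable def taylor (x₀ a₀ a₁ a₂ a₃ a₄ a₅ : ℝ) : ℝ → ℝ := fun x =>
  a₀ + a₁ * (x - x₀) + a₂ * ((x - x₀) ^ 2 / 2) + a₃ * ((x - x₀) ^ 3 / 6)
    + a₄ * ((x - x₀) ^ 4 / 24) + a₅ * ((x - x₀) ^ 5 / 120)

section

variable {x₀ a₀ a₁ a₂ a₃ a₄ a₅ : ℝ}

theorem contDiff_taylor : ContDiff ℝ ∞ (taylor x₀ a₀ a₁ a₂ a₃ a₄ a₅) := by
  unfold taylor
  fun_prop

theorem taylor_self : taylor x₀ a₀ a₁ a₂ a₃ a₄ a₅ x₀ = a₀ := by simp [taylor]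

theorem deriv_taylor :
    deriv (taylor x₀ a₀ a₁ a₂ a₃ a₄ a₅) = taylor x₀ a₁ a₂ a₃ a₄ a₅ 0 := by
  funext x
  have h : HasDerivAt (fun x => x - x₀) 1 x := (hasDerivAt_id x).sub_const x₀
  refine HasDerivAt.deriv (HasDerivAt.congr_deriv ((((((h.const_mul a₁).const_add a₀).add
    (((h.pow 2).div_const 2).const_mul a₂)).add (((h.pow 3).div_const 6).const_mul a₃)).add
    (((h.pow 4).div_const 24).const_mul a₄)).add (((h.pow 5).div_const 120).const_mul a₅)) ?_)
  simp only [taylor]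
  push_cast
  ring

theorem iteratedDeriv_taylor_one : iteratedDeriv 1 (taylor x₀ a₀ a₁ a₂ a₃ a₄ a₅) x₀ = a₁ := by
  simp [iteratedDeriv_succ', deriv_taylor, taylor_self]

theorem iteratedDeriv_taylor_two : iteratedDeriv 2 (taylor x₀ a₀ a₁ a₂ a₃ a₄ a₅) x₀ = a₂ := by
  simp [iteratedDeriv_succ', deriv_taylor, taylor_self]

theorem iteratedDeriv_taylor_three : iteratedDeriv 3 (taylor x₀ a₀ a₁ a₂ a₃ a₄ a₅) x₀ = a₃ := by
  simp [iteratedDeriv_succ', deriv_taylor, taylor_self]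

theorem iteratedDeriv_taylor_four : iteratedDeriv 4 (taylor x₀ a₀ a₁ a₂ a₃ a₄ a₅) x₀ = a₄ := by
  simp [iteratedDeriv_succ', deriv_taylor, taylor_self]

theorem iteratedDeriv_taylor_five : iteratedDeriv 5 (taylor x₀ a₀ a₁ a₂ a₃ a₄ a₅) x₀ = a₅ := by
  simp [iteratedDeriv_succ', deriv_taylor, taylor_self]

variable {g h : ℝ → ℝ}

theorem iteratedDeriv_add_of_smooth (i : ℕ) (hg : ContDiffAt ℝ ∞ g x₀) (hh : ContDiffAt ℝ ∞ h x₀) :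
    iteratedDeriv i (fun x => g x + h x) x₀ = iteratedDeriv i g x₀ + iteratedDeriv i h x₀ :=
  iteratedDeriv_fun_add (hg.of_le ENat.LEInfty.out) (hh.of_le ENat.LEInfty.out)

theorem iteratedDeriv_sub_of_smooth (i : ℕ) (hg : ContDiffAt ℝ ∞ g x₀) (hh : ContDiffAt ℝ ∞ h x₀) :
    iteratedDeriv i (fun x => g x - h x) x₀ = iteratedDeriv i g x₀ - iteratedDeriv i h x₀ :=
  iteratedDeriv_fun_sub (hg.of_le ENat.LEInfty.out) (hh.of_le ENat.LEInfty.out)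

theorem iteratedDeriv_one_mul_taylor (hg : ContDiffAt ℝ ∞ g x₀) :
    iteratedDeriv 1 (fun x => g x * taylor x₀ a₀ a₁ a₂ a₃ a₄ a₅ x) x₀
      = iteratedDeriv 1 g x₀ * a₀ + g x₀ * a₁ := by
  rw [iteratedDeriv_fun_mul (hg.of_le ENat.LEInfty.out)
    (contDiff_taylor.contDiffAt.of_le ENat.LEInfty.out)]
  simp [Finset.sum_range_succ, -iteratedDeriv_one, iteratedDeriv_taylor_one, taylor_self]
  ring

theorem iteratedDeriv_two_mul_taylor (hg : ContDiffAt ℝ ∞ g x₀) :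
    iteratedDeriv 2 (fun x => g x * taylor x₀ a₀ a₁ a₂ a₃ a₄ a₅ x) x₀
      = iteratedDeriv 2 g x₀ * a₀ + 2 * iteratedDeriv 1 g x₀ * a₁ + g x₀ * a₂ := by
  rw [iteratedDeriv_fun_mul (hg.of_le ENat.LEInfty.out)
    (contDiff_taylor.contDiffAt.of_le ENat.LEInfty.out)]
  simp [Finset.sum_range_succ, -iteratedDeriv_one, iteratedDeriv_taylor_one,
    iteratedDeriv_taylor_two, taylor_self]
  ring

theorem iteratedDeriv_four_mul_taylor (hg : ContDiffAt ℝ ∞ g x₀) :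
    iteratedDeriv 4 (fun x => g x * taylor x₀ a₀ a₁ a₂ a₃ a₄ a₅ x) x₀
      = iteratedDeriv 4 g x₀ * a₀ + 4 * iteratedDeriv 3 g x₀ * a₁ + 6 * iteratedDeriv 2 g x₀ * a₂
        + 4 * iteratedDeriv 1 g x₀ * a₃ + g x₀ * a₄ := by
  rw [iteratedDeriv_fun_mul (hg.of_le ENat.LEInfty.out)
    (contDiff_taylor.contDiffAt.of_le ENat.LEInfty.out)]
  have h42 : Nat.choose 4 2 = 6 := rfl
  simp [Finset.sum_range_succ, -iteratedDeriv_one, iteratedDeriv_taylor_one,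
    iteratedDeriv_taylor_two, iteratedDeriv_taylor_three, iteratedDeriv_taylor_four, taylor_self,
    h42]
  ring

/-- The operator `1 - D² + D⁴`. -/
noncomputable def L24 (x₀ : ℝ) (g : ℝ → ℝ) : ℝ :=
  g x₀ - iteratedDeriv 2 g x₀ + iteratedDeriv 4 g x₀

theorem L24_add (hg : ContDiffAt ℝ ∞ g x₀) (hh : ContDiffAt ℝ ∞ h x₀) :
    L24 x₀ (fun x => g x + h x) = L24 x₀ g + L24 x₀ h := by
  simp only [L24, iteratedDeriv_add_of_smooth _ hg hh]
  ring

theorem L24_sub (hg : ContDiffAt ℝ ∞ g x₀) (hh : ContDiffAt ℝ ∞ h x₀) :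
    L24 x₀ (fun x => g x - h x) = L24 x₀ g - L24 x₀ h := by
  simp only [L24, iteratedDeriv_sub_of_smooth _ hg hh]
  ring

/-- The operator 1 - D² + D⁴ is the common shape of the u_tt, u_xxtt, u_xxxxtt terms of Δ. A factor
vanishing to order k at x₀ leaves only the Leibniz terms with at least k derivatives on it, and this
isolates single coefficients below. -/
theorem L24_mul_taylor (hg : ContDiffAt ℝ ∞ g x₀) :
    L24 x₀ (fun x => g x * taylor x₀ a₀ a₁ a₂ a₃ a₄ a₅ x)
      = g x₀ * a₀ - (iteratedDeriv 2 g x₀ * a₀ + 2 * iteratedDeriv 1 g x₀ * a₁ + g x₀ * a₂)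
        + (iteratedDeriv 4 g x₀ * a₀ + 4 * iteratedDeriv 3 g x₀ * a₁
          + 6 * iteratedDeriv 2 g x₀ * a₂ + 4 * iteratedDeriv 1 g x₀ * a₃ + g x₀ * a₄) := by
  rw [L24, iteratedDeriv_two_mul_taylor hg, iteratedDeriv_four_mul_taylor hg, taylor_self]

theorem L24_congr (h' : g =ᶠ[nhds x₀] h) : L24 x₀ g = L24 x₀ h := by
  rw [L24, L24, h'.eq_of_nhds, h'.iteratedDeriv_eq, h'.iteratedDeriv_eq]

end

/-! ### More on partial derivatives of functions of `(x, t, u)` -/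

section

variable {R : Set (ℝ × ℝ × ℝ)} {F G : ℝ → ℝ → ℝ → ℝ}

theorem iteratedDeriv_eq_dX_iterate (i : ℕ) (F : ℝ → ℝ → ℝ → ℝ) (x t u : ℝ) :
    iteratedDeriv i (fun s => F s t u) x = dX^[i] F x t u := by
  induction i generalizing x with
  | zero => simp
  | succ i ih =>
    rw [Function.iterate_succ_apply', iteratedDeriv_succ]
    exact congrArg (fun w => deriv w x) (funext fun s => ih s)

theorem dX_congr (hR : IsOpen R) (h : ∀ x t u, (x, t, u) ∈ R → F x t u = G x t u) :
    ∀ x t u, (x, t, u) ∈ R → dX F x t u = dX G x t u := fun x t u hx =>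
  Filter.EventuallyEq.deriv_eq <| by
    have hc : Continuous (fun s : ℝ => (s, t, u)) := by fun_prop
    filter_upwards [hc.continuousAt.preimage_mem_nhds (hR.mem_nhds hx)] with s hs using h s t u hs

theorem dT_congr (hR : IsOpen R) (h : ∀ x t u, (x, t, u) ∈ R → F x t u = G x t u) :
    ∀ x t u, (x, t, u) ∈ R → dT F x t u = dT G x t u := fun x t u hx =>
  Filter.EventuallyEq.deriv_eq <| by
    have hc : Continuous (fun s : ℝ => (x, s, u)) := by fun_prop
    filter_upwards [hc.continuousAt.preimage_mem_nhds (hR.mem_nhds hx)] with s hs using h x s u hs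

theorem dU_congr (hR : IsOpen R) (h : ∀ x t u, (x, t, u) ∈ R → F x t u = G x t u) :
    ∀ x t u, (x, t, u) ∈ R → dU F x t u = dU G x t u := fun x t u hx =>
  Filter.EventuallyEq.deriv_eq <| by
    have hc : Continuous (fun s : ℝ => (x, t, s)) := by fun_prop
    filter_upwards [hc.continuousAt.preimage_mem_nhds (hR.mem_nhds hx)] with s hs using h x t s hs

theorem dX_eq_zero (hR : IsOpen R) (h : ∀ x t u, (x, t, u) ∈ R → F x t u = 0) :
    ∀ x t u, (x, t, u) ∈ R → dX F x t u = 0 := fun x t u hx => by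
  rw [dX_congr (G := fun _ _ _ => 0) hR h x t u hx]
  simp [dX]

theorem dT_eq_zero (hR : IsOpen R) (h : ∀ x t u, (x, t, u) ∈ R → F x t u = 0) :
    ∀ x t u, (x, t, u) ∈ R → dT F x t u = 0 := fun x t u hx => by
  rw [dT_congr (G := fun _ _ _ => 0) hR h x t u hx]
  simp [dT]

theorem dU_eq_zero (hR : IsOpen R) (h : ∀ x t u, (x, t, u) ∈ R → F x t u = 0) :
    ∀ x t u, (x, t, u) ∈ R → dU F x t u = 0 := fun x t u hx => by
  rw [dU_congr (G := fun _ _ _ => 0) hR h x t u hx]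
  simp [dU]

theorem dX_iterate_eq_zero (hR : IsOpen R) (h : ∀ x t u, (x, t, u) ∈ R → F x t u = 0) (i : ℕ) :
    ∀ x t u, (x, t, u) ∈ R → dX^[i] F x t u = 0 := by
  induction i with
  | zero => exact h
  | succ i ih =>
    rw [Function.iterate_succ']
    exact dX_eq_zero hR ih

theorem Smooth.fderiv_fderiv_comm (hF : Smooth R F) (hR : IsOpen R) {y : ℝ × ℝ × ℝ} (hy : y ∈ R)
    (v w : ℝ × ℝ × ℝ) :
    fderiv ℝ (fun p => fderiv ℝ (fun p : ℝ × ℝ × ℝ => F p.1 p.2.1 p.2.2) p v) y w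
      = fderiv ℝ (fun p => fderiv ℝ (fun p : ℝ × ℝ × ℝ => F p.1 p.2.1 p.2.2) p w) y v := by
  have hs := (hF.contDiffAt (hR.mem_nhds hy)).isSymmSndFDerivAt
    (by simpa using ENat.LEInfty.out (m := 2))
  have hd : DifferentiableAt ℝ (fderiv ℝ (fun p : ℝ × ℝ × ℝ => F p.1 p.2.1 p.2.2)) y :=
    ((ContDiffOn.fderiv_of_isOpen hF hR (m := ∞) (by simp)).contDiffAt
      (hR.mem_nhds hy)).differentiableAt (by simp)
  rw [fderiv_clm_apply hd (differentiableAt_const v),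
    fderiv_clm_apply hd (differentiableAt_const w)]
  simpa using hs w v

theorem Smooth.dX_dT_comm (hF : Smooth R F) (hR : IsOpen R) :
    ∀ x t u, (x, t, u) ∈ R → dX (dT F) x t u = dT (dX F) x t u := fun x t u h => by
  rw [(hF.smooth_dT hR).dX_eq hR h, (hF.smooth_dX hR).dT_eq hR h]
  have e1 : (fun p : ℝ × ℝ × ℝ => dT F p.1 p.2.1 p.2.2) =ᶠ[nhds (x, t, u)] fun p =>
      fderiv ℝ (fun p : ℝ × ℝ × ℝ => F p.1 p.2.1 p.2.2) p (0, 1, 0) := by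
    filter_upwards [hR.mem_nhds h] with p hp using hF.dT_eq hR hp
  have e2 : (fun p : ℝ × ℝ × ℝ => dX F p.1 p.2.1 p.2.2) =ᶠ[nhds (x, t, u)] fun p =>
      fderiv ℝ (fun p : ℝ × ℝ × ℝ => F p.1 p.2.1 p.2.2) p (1, 0, 0) := by
    filter_upwards [hR.mem_nhds h] with p hp using hF.dX_eq hR hp
  rw [e1.fderiv_eq, e2.fderiv_eq, hF.fderiv_fderiv_comm hR h]

theorem Smooth.dU_dX_comm (hF : Smooth R F) (hR : IsOpen R) :
    ∀ x t u, (x, t, u) ∈ R → dU (dX F) x t u = dX (dU F) x t u := fun x t u h => by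
  rw [(hF.smooth_dX hR).dU_eq hR h, (hF.smooth_dU hR).dX_eq hR h]
  have e1 : (fun p : ℝ × ℝ × ℝ => dU F p.1 p.2.1 p.2.2) =ᶠ[nhds (x, t, u)] fun p =>
      fderiv ℝ (fun p : ℝ × ℝ × ℝ => F p.1 p.2.1 p.2.2) p (0, 0, 1) := by
    filter_upwards [hR.mem_nhds h] with p hp using hF.dU_eq hR hp
  have e2 : (fun p : ℝ × ℝ × ℝ => dX F p.1 p.2.1 p.2.2) =ᶠ[nhds (x, t, u)] fun p =>
      fderiv ℝ (fun p : ℝ × ℝ × ℝ => F p.1 p.2.1 p.2.2) p (1, 0, 0) := by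
    filter_upwards [hR.mem_nhds h] with p hp using hF.dX_eq hR hp
  rw [e1.fderiv_eq, e2.fderiv_eq, hF.fderiv_fderiv_comm hR h]

theorem Smooth.dU_dT_comm (hF : Smooth R F) (hR : IsOpen R) :
    ∀ x t u, (x, t, u) ∈ R → dU (dT F) x t u = dT (dU F) x t u := fun x t u h => by
  rw [(hF.smooth_dT hR).dU_eq hR h, (hF.smooth_dU hR).dT_eq hR h]
  have e1 : (fun p : ℝ × ℝ × ℝ => dU F p.1 p.2.1 p.2.2) =ᶠ[nhds (x, t, u)] fun p =>
      fderiv ℝ (fun p : ℝ × ℝ × ℝ => F p.1 p.2.1 p.2.2) p (0, 0, 1) := by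
    filter_upwards [hR.mem_nhds h] with p hp using hF.dU_eq hR hp
  have e2 : (fun p : ℝ × ℝ × ℝ => dT F p.1 p.2.1 p.2.2) =ᶠ[nhds (x, t, u)] fun p =>
      fderiv ℝ (fun p : ℝ × ℝ × ℝ => F p.1 p.2.1 p.2.2) p (0, 1, 0) := by
    filter_upwards [hR.mem_nhds h] with p hp using hF.dT_eq hR hp
  rw [e1.fderiv_eq, e2.fderiv_eq, hF.fderiv_fderiv_comm hR h]

theorem Smooth.contDiffAt_x (hF : Smooth R F) (hR : IsOpen R) {p : ℝ → ℝ} (hp : ContDiff ℝ ∞ p)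
    {x t : ℝ} (h : (x, t, p x) ∈ R) : ContDiffAt ℝ ∞ (fun x => F x t (p x)) x :=
  hF.contDiffAt_comp hR (a := id) (b := fun _ => t) h contDiffAt_id contDiffAt_const hp.contDiffAt

end

section

variable {V : VField} {D : Set (ℝ × ℝ)} {J : Set ℝ} {t₀ : ℝ} {p q r z : ℝ → ℝ}

theorem contDiffAt_char₀ (hV : V.SmoothOn D J) (hD : IsOpen D) (hJ : IsOpen J)
    (hp : ContDiff ℝ ∞ p) (hq : ContDiff ℝ ∞ q) {x : ℝ} (hx : (x, t₀, p x) ∈ region D J) :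
    ContDiffAt ℝ ∞ (V.char₀ t₀ p q) x := by
  have hR := isOpen_region hD hJ
  have hs : ∀ {F}, Smooth (region D J) F → ContDiffAt ℝ ∞ (fun x => F x t₀ (p x)) x :=
    fun hF => hF.contDiffAt_x hR hp hx
  exact ((hs hV.2.2).sub ((hs hV.1).mul (contDiff_infty_iff_deriv.1 hp).2.contDiffAt)).sub
    ((hs hV.2.1).mul hq.contDiffAt)

theorem Smooth.contDiffAt_dt₁ {F : ℝ → ℝ → ℝ → ℝ} {R : Set (ℝ × ℝ × ℝ)} (hF : Smooth R F)
    (hR : IsOpen R) (hp : ContDiff ℝ ∞ p) (hq : ContDiff ℝ ∞ q) {x : ℝ} (hx : (x, t₀, p x) ∈ R) :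
    ContDiffAt ℝ ∞ (fun x => dt₁ F x t₀ (p x) (q x)) x :=
  ((hF.smooth_dT hR).contDiffAt_x hR hp hx).add
    (((hF.smooth_dU hR).contDiffAt_x hR hp hx).mul hq.contDiffAt)

theorem Smooth.contDiffAt_dt₂ {F : ℝ → ℝ → ℝ → ℝ} {R : Set (ℝ × ℝ × ℝ)} (hF : Smooth R F)
    (hR : IsOpen R) (hp : ContDiff ℝ ∞ p) (hq : ContDiff ℝ ∞ q) (hr : ContDiff ℝ ∞ r) {x : ℝ}
    (hx : (x, t₀, p x) ∈ R) :
    ContDiffAt ℝ ∞ (fun x => dt₂ F x t₀ (p x) (q x) (r x)) x := by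
  have hT := hF.smooth_dT hR
  have hU := hF.smooth_dU hR
  exact (((hT.smooth_dT hR).contDiffAt_x hR hp hx).add
    ((((hT.smooth_dU hR).contDiffAt_x hR hp hx).add
    ((hU.smooth_dT hR).contDiffAt_x hR hp hx)).mul hq.contDiffAt)).add
    (((hU.smooth_dU hR).contDiffAt_x hR hp hx).mul (hq.contDiffAt.pow 2)) |>.add
    ((hU.contDiffAt_x hR hp hx).mul hr.contDiffAt)

theorem contDiffAt_char₂ (hV : V.SmoothOn D J) (hD : IsOpen D) (hJ : IsOpen J)
    (hp : ContDiff ℝ ∞ p) (hq : ContDiff ℝ ∞ q) (hr : ContDiff ℝ ∞ r) (hz : ContDiff ℝ ∞ z)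
    {x : ℝ} (hx : (x, t₀, p x) ∈ region D J) :
    ContDiffAt ℝ ∞ (V.char₂ t₀ p q r z) x := by
  have hR := isOpen_region hD hJ
  have hs : ∀ {F}, Smooth (region D J) F → ContDiffAt ℝ ∞ (fun x => F x t₀ (p x)) x :=
    fun hF => hF.contDiffAt_x hR hp hx
  have hd : ∀ {g : ℝ → ℝ}, ContDiff ℝ ∞ g → ContDiffAt ℝ ∞ (deriv g) x := fun hg =>
    (contDiff_infty_iff_deriv.1 hg).2.contDiffAt
  have h1 : ∀ {F}, Smooth (region D J) F → ContDiffAt ℝ ∞ (fun x => 2 * dt₁ F x t₀ (p x) (q x)) x :=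
    fun hF => contDiffAt_const.mul (hF.contDiffAt_dt₁ hR hp hq hx)
  have h2 : ∀ {F}, Smooth (region D J) F →
      ContDiffAt ℝ ∞ (fun x => dt₂ F x t₀ (p x) (q x) (r x)) x :=
    fun hF => hF.contDiffAt_dt₂ hR hp hq hr hx
  exact ((h2 hV.2.2).sub ((((h2 hV.1).mul (hd hp)).add ((h1 hV.1).mul (hd hq))).add
    ((hs hV.1).mul (hd hr)))).sub ((((h2 hV.2.1).mul hq.contDiffAt).add
      ((h1 hV.2.1).mul hr.contDiffAt)).add ((hs hV.2.1).mul hz.contDiffAt))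

/-- The infinitesimal invariance criterion along a polynomial test function. -/
theorem VField.IsLieSymmetry.determining_taylor {c : ℝ} {f : ℝ → ℝ} (h : V.IsLieSymmetry c f D J)
    (hV : V.SmoothOn D J) (hD : IsOpen D) (hJ : IsOpen J) (hf : ContDiffOn ℝ ∞ f J) {x v : ℝ}
    (hx : (x, t₀) ∈ D) (hv : v ∈ J) (hq : ContDiff ℝ ∞ q) (hz : ContDiff ℝ ∞ z)
    (p₁ p₂ p₄ r₀ r₂ r₃ : ℝ) {r₄ : ℝ}
    (hΔ : r₄ = r₂ - r₀ - c * p₄ + (1 + deriv f v) * p₂ + deriv (deriv f) v * p₁ ^ 2) :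
    L24 x (V.char₂ t₀ (taylor x v p₁ p₂ 0 p₄ 0) q (taylor x r₀ 0 r₂ r₃ r₄ 0) z)
      - V.ξ x t₀ v * r₃ + V.τ x t₀ v * L24 x z
      + c * (iteratedDeriv 4 (V.char₀ t₀ (taylor x v p₁ p₂ 0 p₄ 0) q) x
        + V.τ x t₀ v * iteratedDeriv 4 q x)
      - (1 + deriv f v) * (iteratedDeriv 2 (V.char₀ t₀ (taylor x v p₁ p₂ 0 p₄ 0) q) x
        + V.τ x t₀ v * iteratedDeriv 2 q x)
      - deriv (deriv f) v * V.η x t₀ v * p₂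
      - 2 * deriv (deriv f) v * p₁ * (iteratedDeriv 1 (V.char₀ t₀ (taylor x v p₁ p₂ 0 p₄ 0) q) x
        + V.ξ x t₀ v * p₂ + V.τ x t₀ v * iteratedDeriv 1 q x)
      - deriv (deriv (deriv f)) v * V.η x t₀ v * p₁ ^ 2 = 0 := by
  -- With the third and fifth coefficients of p and the first and fifth of r set to zero, the only
  -- explicit ξ terms left are those with r₃ and p₂. The value of r₄ is dictated by Δ = 0.
  have key := h.determining hV hD hJ hf (p := taylor x v p₁ p₂ 0 p₄ 0) (q := q)
    (r := taylor x r₀ 0 r₂ r₃ r₄ 0) (z := z) contDiff_taylor hq contDiff_taylor hz hx hv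
    taylor_self (by
      rw [taylor_self, iteratedDeriv_taylor_two, iteratedDeriv_taylor_four,
        iteratedDeriv_taylor_four, iteratedDeriv_taylor_two, iteratedDeriv_taylor_one, hΔ]
      ring)
  rw [iteratedDeriv_taylor_one, iteratedDeriv_taylor_three, iteratedDeriv_taylor_five,
    iteratedDeriv_taylor_five, iteratedDeriv_taylor_three, iteratedDeriv_taylor_two,
    iteratedDeriv_taylor_one] at key
  simp only [L24]
  linear_combination key

end

/-! ### First consequences of the invariance criterion -/

section

variable {V : VField} {D : Set (ℝ × ℝ)} {J : Set ℝ} {c : ℝ} {f : ℝ → ℝ}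

theorem contDiff_const_zero : ContDiff ℝ ∞ (0 : ℝ → ℝ) := contDiff_const

/-- The coefficient of `u_xxxttt`. -/
theorem VField.IsLieSymmetry.dX_τ_add (h : V.IsLieSymmetry c f D J) (hV : V.SmoothOn D J)
    (hD : IsOpen D) (hJ : IsOpen J) (hf : ContDiffOn ℝ ∞ f J) {x t v : ℝ}
    (hx : (x, t, v) ∈ region D J) (a : ℝ) : dX V.τ x t v + dU V.τ x t v * a = 0 := by
  have hR := isOpen_region hD hJ
  set p := taylor x v a 0 0 0 0 with hp
  set r := taylor x 0 0 0 0 (deriv (deriv f) v * a ^ 2) 0 with hr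
  have hpv : p x = v := taylor_self
  have hpc : ContDiff ℝ ∞ p := contDiff_taylor
  have hrc : ContDiff ℝ ∞ r := contDiff_taylor
  have hx' : (x, t, p x) ∈ region D J := by rwa [hpv]
  have hτ : ContDiffAt ℝ ∞ (fun y => V.τ y t (p y)) x :=
    Smooth.contDiffAt_x hV.2.1 hR hpc hx'
  have h0 := h.determining_taylor hV hD hJ hf hx.1 hx.2 contDiff_const_zero
    contDiff_const_zero a 0 0 0 0 0 (r₄ := deriv (deriv f) v * a ^ 2) (by ring)
  have h1 := h.determining_taylor hV hD hJ hf hx.1 hx.2 contDiff_const_zero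
    (contDiff_taylor (x₀ := x) (a₀ := 0) (a₁ := 0) (a₂ := 0) (a₃ := 1) (a₄ := 0) (a₅ := 0)) a 0 0
    0 0 0 (r₄ := deriv (deriv f) v * a ^ 2) (by ring)
  have hz : L24 x (taylor x 0 0 0 1 0 0) = 0 := by
    simp [L24, taylor_self, iteratedDeriv_taylor_two, iteratedDeriv_taylor_four]
  have hz0 : L24 x (0 : ℝ → ℝ) = 0 := by
    change L24 x (fun _ => 0) = 0
    simp [L24]
  rw [← hp, ← hr, hz] at h1
  rw [← hp, ← hr, hz0] at h0
  -- The two jets differ only in u_xxxttt. Since z enters the characteristic's second t-derivative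
  -- only through -τ z, and z = (y - x)³/6, the difference is -4 times the total x-derivative of τ.
  have e : V.char₂ t p 0 r (taylor x 0 0 0 1 0 0) = fun y => V.char₂ t p 0 r 0 y
      - V.τ y t (p y) * taylor x 0 0 0 1 0 0 y := by
    funext y
    simp only [VField.char₂, Pi.zero_apply]
    ring
  rw [e, L24_sub (contDiffAt_char₂ hV hD hJ hpc contDiff_const_zero hrc contDiff_const_zero hx')
    (hτ.mul contDiff_taylor.contDiffAt), L24_mul_taylor hτ] at h1
  have hd : iteratedDeriv 1 (fun y => V.τ y t (p y)) x = dX V.τ x t v + dU V.τ x t v * a := by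
    rw [iteratedDeriv_one]
    have hpd : HasDerivAt p (deriv p x) x := (hpc.differentiable (by simp) x).hasDerivAt
    rw [hp, deriv_taylor, taylor_self, ← hp] at hpd
    have := (Smooth.hasDerivAt_x hV.2.1 hR hx' hpd).deriv
    rwa [hpv] at this
  rw [hd] at h1
  linear_combination (h0 - h1) / 4

/-- The coefficient of `u_xxxxxt`. -/
theorem VField.IsLieSymmetry.dT_ξ_add (h : V.IsLieSymmetry c f D J) (hV : V.SmoothOn D J)
    (hD : IsOpen D) (hJ : IsOpen J) (hf : ContDiffOn ℝ ∞ f J) {x t v : ℝ}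
    (hx : (x, t, v) ∈ region D J) (b : ℝ) : dT V.ξ x t v + dU V.ξ x t v * b = 0 := by
  have hR := isOpen_region hD hJ
  set p := taylor x v 0 0 0 0 0 with hp
  set r := taylor x 0 0 0 0 0 0 with hr
  set q := taylor x b 0 0 0 0 0 with hq
  set q' := taylor x b 0 0 0 0 1 with hq'
  set w := taylor x 0 0 0 0 0 1 with hw
  set w' := taylor x 0 0 0 0 1 0 with hw'
  have hpv : p x = v := taylor_self
  have hpc : ContDiff ℝ ∞ p := contDiff_taylor
  have hrc : ContDiff ℝ ∞ r := contDiff_taylor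
  have hqc : ContDiff ℝ ∞ q := contDiff_taylor
  have hqc' : ContDiff ℝ ∞ q' := contDiff_taylor
  have hwc : ContDiff ℝ ∞ w := contDiff_taylor
  have hwc' : ContDiff ℝ ∞ w' := contDiff_taylor
  have hx' : (x, t, p x) ∈ region D J := by rwa [hpv]
  have hs : ∀ {F}, Smooth (region D J) F → ContDiffAt ℝ ∞ (fun y => F y t (p y)) x :=
    fun hF => hF.contDiffAt_x hR hpc hx'
  have h0 := h.determining_taylor hV hD hJ hf hx.1 hx.2 hqc contDiff_const_zero 0 0 0
    0 0 0 (r₄ := 0) (by ring)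
  have h1 := h.determining_taylor hV hD hJ hf hx.1 hx.2 hqc' contDiff_const_zero 0 0 0
    0 0 0 (r₄ := 0) (by ring)
  rw [← hp, ← hr] at h0 h1
  have hqw : ∀ y, q' y = q y + w y := fun y => by
    simp only [hq, hq', hw, taylor]
    ring
  have hqb : ∀ y, q y = b := fun y => by
    simp [hq, taylor]
  have hdp : deriv p = 0 := by
    rw [hp, deriv_taylor]
    funext y
    simp [taylor]
  have hdq : deriv q = 0 := by
    rw [hq, deriv_taylor]
    funext y
    simp [taylor]
  have hdr : deriv r = 0 := by
    rw [hr, deriv_taylor]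
    funext y
    simp [taylor]
  have hr0 : ∀ y, r y = 0 := fun y => by
    simp [hr, taylor]
  have hdq' : deriv q' = w' := by
    rw [hq', deriv_taylor]
  -- Adding w = (y - x)⁵/120 to q changes the second t-derivative of the characteristic by G w - 2 H
  -- w', with `H` as set below. The factors 2b + w and 3b² + 3bw + w² come from the differences of
  -- squares and cubes of q. As w vanishes to fifth order, G w is invisible to four derivatives; w'
  -- = (y - x)⁴/24 contributes exactly -2 H(x).
  set G : ℝ → ℝ := fun y => (dU (dT V.η) y t (p y) + dT (dU V.η) y t (p y))
      + dU (dU V.η) y t (p y) * (2 * b + w y) - dT (dT V.τ) y t (p y)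
      - (dU (dT V.τ) y t (p y) + dT (dU V.τ) y t (p y)) * (2 * b + w y)
      - dU (dU V.τ) y t (p y) * (3 * b ^ 2 + 3 * b * w y + w y ^ 2)
      - 2 * dU V.ξ y t (p y) * w' y with hG
  have hGc : ContDiffAt ℝ ∞ G x := by
    have e1 := hs (Smooth.smooth_dU (Smooth.smooth_dT hV.2.2 hR) hR)
    have e2 := hs (Smooth.smooth_dT (Smooth.smooth_dU hV.2.2 hR) hR)
    have e3 := hs (Smooth.smooth_dU (Smooth.smooth_dU hV.2.2 hR) hR)
    have e4 := hs (Smooth.smooth_dT (Smooth.smooth_dT hV.2.1 hR) hR)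
    have e5 := hs (Smooth.smooth_dU (Smooth.smooth_dT hV.2.1 hR) hR)
    have e6 := hs (Smooth.smooth_dT (Smooth.smooth_dU hV.2.1 hR) hR)
    have e7 := hs (Smooth.smooth_dU (Smooth.smooth_dU hV.2.1 hR) hR)
    have e8 := hs (Smooth.smooth_dU hV.1 hR)
    fun_prop
  set H : ℝ → ℝ := fun y => dT V.ξ y t (p y) + dU V.ξ y t (p y) * b with hH
  have hHc : ContDiffAt ℝ ∞ H x :=
    (hs (Smooth.smooth_dT hV.1 hR)).add ((hs (Smooth.smooth_dU hV.1 hR)).mul contDiffAt_const)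
  have hGw : ContDiffAt ℝ ∞ (fun y => G y * w y) x := hGc.mul hwc.contDiffAt
  have hHw : ContDiffAt ℝ ∞ (fun y => H y * w' y) x := hHc.mul hwc'.contDiffAt
  have hC : ContDiffAt ℝ ∞ (V.char₂ t p q r 0) x :=
    contDiffAt_char₂ hV hD hJ hpc hqc hrc contDiff_const_zero hx'
  have e : V.char₂ t p q' r 0 = fun y => V.char₂ t p q r 0 y + G y * w y
      - (H y * w' y + H y * w' y) := by
    funext y
    simp only [VField.char₂, Pi.zero_apply, hdp, hdq, hdq', hqw, hr0, dt₁, dt₂, hqb, hG, hH, hdr]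
    ring
  have e' : V.char₀ t p q' = fun y => V.char₀ t p q y - V.τ y t (p y) * w y := by
    funext y
    simp only [VField.char₀, hqw]
    ring
  have hτ := hs hV.2.1
  have hC0 : ContDiffAt ℝ ∞ (V.char₀ t p q) x := contDiffAt_char₀ hV hD hJ hpc hqc hx'
  have hτw : ContDiffAt ℝ ∞ (fun y => V.τ y t (p y) * w y) x := hτ.mul hwc.contDiffAt
  rw [e, L24_sub (hC.add hGw) (hHw.add hHw), L24_add hC hGw, L24_add hHw hHw, hw, hw',
    L24_mul_taylor hGc, L24_mul_taylor hHc, e', iteratedDeriv_sub_of_smooth _ hC0 hτw,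
    iteratedDeriv_sub_of_smooth _ hC0 hτw, iteratedDeriv_sub_of_smooth _ hC0 hτw,
    hw, iteratedDeriv_four_mul_taylor hτ, iteratedDeriv_two_mul_taylor hτ,
    iteratedDeriv_one_mul_taylor hτ, hq', iteratedDeriv_taylor_one, iteratedDeriv_taylor_two,
    iteratedDeriv_taylor_four] at h1
  rw [hq, iteratedDeriv_taylor_one, iteratedDeriv_taylor_two, iteratedDeriv_taylor_four, ← hq] at h0
  have hHx : H x = dT V.ξ x t v + dU V.ξ x t v * b := by
    simp only [hH, hpv]
  rw [hHx] at h1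
  linear_combination (h0 - h1) / 2

end

section

variable {V : VField} {D : Set (ℝ × ℝ)} {J : Set ℝ} {c : ℝ} {f : ℝ → ℝ}

/-- The coefficient of `u_xxxtt`. -/
theorem VField.IsLieSymmetry.dX_dU_η_add (h : V.IsLieSymmetry c f D J) (hV : V.SmoothOn D J)
    (hD : IsOpen D) (hJ : IsOpen J) (hf : ContDiffOn ℝ ∞ f J)
    (hξ : ∀ x t v, (x, t, v) ∈ region D J → dU V.ξ x t v = 0)
    (hτx : ∀ x t v, (x, t, v) ∈ region D J → dX V.τ x t v = 0)
    (hτu : ∀ x t v, (x, t, v) ∈ region D J → dU V.τ x t v = 0) {x t v : ℝ}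
    (hx : (x, t, v) ∈ region D J) (a : ℝ) :
    2 * (dX (dU V.η) x t v + dU (dU V.η) x t v * a) = 3 * dX (dX V.ξ) x t v := by
  have hR := isOpen_region hD hJ
  have hSξ : Smooth (region D J) V.ξ := hV.1
  have hSτ : Smooth (region D J) V.τ := hV.2.1
  have hSη : Smooth (region D J) V.η := hV.2.2
  set p := taylor x v a 0 0 0 0 with hp
  set r := taylor x 0 0 0 0 (deriv (deriv f) v * a ^ 2) 0 with hr
  set r' := taylor x 0 0 0 1 (deriv (deriv f) v * a ^ 2) 0 with hr'
  set w := taylor x 0 0 0 1 0 0 with hw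
  set w' := taylor x 0 0 1 0 0 0 with hw'
  have hpv : p x = v := taylor_self
  have hpc : ContDiff ℝ ∞ p := contDiff_taylor
  have hrc : ContDiff ℝ ∞ r := contDiff_taylor
  have hwc : ContDiff ℝ ∞ w := contDiff_taylor
  have hwc' : ContDiff ℝ ∞ w' := contDiff_taylor
  have hx' : (x, t, p x) ∈ region D J := by rwa [hpv]
  have hs : ∀ {F}, Smooth (region D J) F → ContDiffAt ℝ ∞ (fun y => F y t (p y)) x :=
    fun hF => hF.contDiffAt_x hR hpc hx'
  have h0 := h.determining_taylor hV hD hJ hf hx.1 hx.2 contDiff_const_zero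
    contDiff_const_zero a 0 0 0 0 0 (r₄ := deriv (deriv f) v * a ^ 2) (by ring)
  have h1 := h.determining_taylor hV hD hJ hf hx.1 hx.2 contDiff_const_zero
    contDiff_const_zero a 0 0 0 0 1 (r₄ := deriv (deriv f) v * a ^ 2) (by ring)
  rw [← hp, ← hr] at h0
  rw [← hp, ← hr'] at h1
  have hrw : ∀ y, r' y = r y + w y := fun y => by
    simp only [hr, hr', hw, taylor]
    ring
  have hdrw : ∀ y, deriv r' y = deriv r y + w' y := fun y => by
    simp only [hr, hr', hw', deriv_taylor, taylor]
    ring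
  have hdp : ∀ y, deriv p y = a := fun y => by
    simp [hp, deriv_taylor, taylor]
  -- `G` collects the coefficients of u_tt in Q_tt when u_t = 0. Perturbing r by (y - x)³/6 gives 4
  -- G' - 6 D_x²ξ; the undifferentiated ξ terms cancel against -ξ r₃.
  set G : ℝ → ℝ := fun y => dU V.η y t (p y) - dU V.ξ y t (p y) * a
    - 2 * dT V.τ y t (p y) with hG
  have e1 := hs (hSη.smooth_dU hR)
  have e2 := hs (hSξ.smooth_dU hR)
  have e3 := hs (hSτ.smooth_dT hR)
  have hGc : ContDiffAt ℝ ∞ G x := by fun_prop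
  have hξc := hs hSξ
  have hGw : ContDiffAt ℝ ∞ (fun y => G y * w y) x := hGc.mul hwc.contDiffAt
  have hξw : ContDiffAt ℝ ∞ (fun y => V.ξ y t (p y) * w' y) x := hξc.mul hwc'.contDiffAt
  have hC : ContDiffAt ℝ ∞ (V.char₂ t p 0 r 0) x :=
    contDiffAt_char₂ hV hD hJ hpc contDiff_const_zero hrc contDiff_const_zero hx'
  have e : V.char₂ t p 0 r' 0 = fun y => V.char₂ t p 0 r 0 y + G y * w y
      - V.ξ y t (p y) * w' y := by
    funext y
    simp only [VField.char₂, Pi.zero_apply, hdp, hrw, hdrw, dt₁, dt₂, hG]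
    ring
  have hpd : ∀ y, HasDerivAt p a y := fun y => by
    rw [← hdp y]
    exact (hpc.differentiable (by simp) y).hasDerivAt
  have hd : ∀ {F}, Smooth (region D J) F →
      HasDerivAt (fun y => F y t (p y)) (dX F x t v + dU F x t v * a) x := fun hF => by
    have := hF.hasDerivAt_x hR hx' (hpd x)
    rwa [hpv] at this
  have hG1 : iteratedDeriv 1 G x = dX (dU V.η) x t v + dU (dU V.η) x t v * a := by
    rw [iteratedDeriv_one, hG]
    refine (((hd (hSη.smooth_dU hR)).sub ((hd (hSξ.smooth_dU hR)).mul_const a)).sub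
      ((hd (hSτ.smooth_dT hR)).const_mul 2)).deriv.trans ?_
    rw [dX_eq_zero hR hξ x t v hx,
      dU_eq_zero hR hξ x t v hx, hSτ.dX_dT_comm hR x t v hx, hSτ.dU_dT_comm hR x t v hx,
      dT_eq_zero hR hτx x t v hx, dT_eq_zero hR hτu x t v hx]
    ring
  have hξ2 : iteratedDeriv 2 (fun y => V.ξ y t (p y)) x = dX (dX V.ξ) x t v := by
    have hc : Continuous (fun y => (y, t, p y)) := by
      have := hpc.continuous
      fun_prop
    have hev : deriv (fun y => V.ξ y t (p y)) =ᶠ[nhds x] fun y => dX V.ξ y t (p y) := by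
      filter_upwards [hc.continuousAt.preimage_mem_nhds (hR.mem_nhds hx')] with y hy
      rw [(hSξ.hasDerivAt_x hR hy (hpd y)).deriv, hξ _ _ _ hy]
      ring
    rw [iteratedDeriv_succ, iteratedDeriv_one, hev.deriv_eq, (hd (hSξ.smooth_dX hR)).deriv,
      hSξ.dU_dX_comm hR x t v hx, dX_eq_zero hR hξ x t v hx]
    ring
  rw [e, L24_sub (hC.add hGw) hξw, L24_add hC hGw, hw, hw', L24_mul_taylor hGc,
    L24_mul_taylor hξc, hG1, hξ2, hpv] at h1
  linear_combination (h1 - h0) / 2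

theorem exists_ne_mem (hJ : IsOpen J) {v : ℝ} (hv : v ∈ J) : ∃ w ∈ J, w ≠ v := by
  have h : ∀ᶠ w in nhdsWithin v {v}ᶜ, w ∈ J := nhdsWithin_le_nhds (hJ.mem_nhds hv)
  obtain ⟨w, hw, hne⟩ := (h.and self_mem_nhdsWithin).exists
  exact ⟨w, hw, hne⟩

/-- A function with vanishing second `u`-derivative is affine in `u`. -/
theorem Smooth.eq_affine {F : ℝ → ℝ → ℝ → ℝ} (hF : Smooth (region D J) F) (hD : IsOpen D)
    (hJ : IsOpen J) (hJc : J.OrdConnected)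
    (h : ∀ x t v, (x, t, v) ∈ region D J → dU (dU F) x t v = 0) {x t v w : ℝ} (hx : (x, t) ∈ D)
    (hv : v ∈ J) (hw : w ∈ J) : F x t w = F x t v + (w - v) * dU F x t v := by
  have hR := isOpen_region hD hJ
  have hd : ∀ {F}, Smooth (region D J) F → ∀ u ∈ J,
      HasDerivAt (fun u => F x t u) (dU F x t u) u := fun hF u hu => by
    have := hF.hasDerivAt_comp hR (a := fun _ => x) (b := fun _ => t) (v := id) (s := u) ⟨hx, hu⟩
      (hasDerivAt_const u x) (hasDerivAt_const u t) (hasDerivAt_id u)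
    simpa using this
  have hJp : IsPreconnected J := hJc.isPreconnected
  have h1 : ∀ u ∈ J, dU F x t u = dU F x t v := fun u hu =>
    hJ.is_const_of_deriv_eq_zero hJp
      (fun u hu => (hd (hF.smooth_dU hR) u hu).differentiableAt.differentiableWithinAt)
      (fun u hu => h x t u ⟨hx, hu⟩) hu hv
  have h2 : ∀ u ∈ J, HasDerivAt (fun u => F x t u - u * dU F x t v) 0 u := fun u hu => by
    have := (hd hF u hu).sub ((hasDerivAt_id u).mul_const (dU F x t v))
    rw [h1 u hu, one_mul, sub_self] at this
    exact this
  have h3 := hJ.is_const_of_deriv_eq_zero hJp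
    (fun u hu => (h2 u hu).differentiableAt.differentiableWithinAt)
    (fun u hu => (h2 u hu).deriv) hw hv
  linear_combination h3

/-- A function with vanishing `u`-derivative does not depend on `u`. -/
theorem Smooth.eq_of_dU_eq_zero {F : ℝ → ℝ → ℝ → ℝ} (hF : Smooth (region D J) F) (hD : IsOpen D)
    (hJ : IsOpen J) (hJc : J.OrdConnected)
    (h : ∀ x t v, (x, t, v) ∈ region D J → dU F x t v = 0) {x t v w : ℝ} (hx : (x, t) ∈ D)
    (hv : v ∈ J) (hw : w ∈ J) : F x t w = F x t v := by
  rw [hF.eq_affine hD hJ hJc (dU_eq_zero (isOpen_region hD hJ) h) hx hv hw, h x t v ⟨hx, hv⟩]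
  ring

/-- The point symmetries whose coefficients satisfy the equations that come from the derivatives
of highest order. -/
structure VField.IsSemiAffine (V : VField) (D : Set (ℝ × ℝ)) (J : Set ℝ) : Prop where
  dT_ξ : ∀ x t v, (x, t, v) ∈ region D J → dT V.ξ x t v = 0
  dU_ξ : ∀ x t v, (x, t, v) ∈ region D J → dU V.ξ x t v = 0
  dX_τ : ∀ x t v, (x, t, v) ∈ region D J → dX V.τ x t v = 0
  dU_τ : ∀ x t v, (x, t, v) ∈ region D J → dU V.τ x t v = 0
  dU_dU_η : ∀ x t v, (x, t, v) ∈ region D J → dU (dU V.η) x t v = 0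
  dX_dU_η : ∀ x t v, (x, t, v) ∈ region D J →
    2 * dX (dU V.η) x t v = 3 * dX (dX V.ξ) x t v

/-- Each top-order relation is affine in a still free first-order coordinate, u_x or u_t; its values
at 0 and 1 separate the two coefficients. -/
theorem VField.IsLieSymmetry.isSemiAffine (h : V.IsLieSymmetry c f D J) (hV : V.SmoothOn D J)
    (hD : IsOpen D) (hJ : IsOpen J) (hf : ContDiffOn ℝ ∞ f J) : V.IsSemiAffine D J := by
  have h1 : ∀ x t v, (x, t, v) ∈ region D J → dT V.ξ x t v = 0 := fun x t v hx => by
    simpa using h.dT_ξ_add hV hD hJ hf hx 0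
  have h2 : ∀ x t v, (x, t, v) ∈ region D J → dU V.ξ x t v = 0 := fun x t v hx => by
    simpa [h1 x t v hx] using h.dT_ξ_add hV hD hJ hf hx 1
  have h3 : ∀ x t v, (x, t, v) ∈ region D J → dX V.τ x t v = 0 := fun x t v hx => by
    simpa using h.dX_τ_add hV hD hJ hf hx 0
  have h4 : ∀ x t v, (x, t, v) ∈ region D J → dU V.τ x t v = 0 := fun x t v hx => by
    simpa [h3 x t v hx] using h.dX_τ_add hV hD hJ hf hx 1
  have h5 : ∀ x t v, (x, t, v) ∈ region D J →
      2 * dX (dU V.η) x t v = 3 * dX (dX V.ξ) x t v := fun x t v hx => by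
    simpa using h.dX_dU_η_add hV hD hJ hf h2 h3 h4 hx 0
  refine ⟨h1, h2, h3, h4, fun x t v hx => ?_, h5⟩
  linear_combination (h.dX_dU_η_add hV hD hJ hf h2 h3 h4 hx 1 - h5 x t v hx) / 2

end

/-! ### The invariance criterion for ξ = ξ(x), τ = τ(t) and η affine in u -/

section

variable {V : VField} {D : Set (ℝ × ℝ)} {J : Set ℝ} {c : ℝ} {f : ℝ → ℝ}

theorem Smooth.dU_dU_dT_eq_zero {R : Set (ℝ × ℝ × ℝ)} {F : ℝ → ℝ → ℝ → ℝ} (hF : Smooth R F)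
    (hR : IsOpen R) (h : ∀ x t v, (x, t, v) ∈ R → dU (dU F) x t v = 0) :
    ∀ x t v, (x, t, v) ∈ R → dU (dU (dT F)) x t v = 0 := fun x t v hx => by
  rw [dU_congr hR (hF.dU_dT_comm hR) x t v hx, (hF.smooth_dU hR).dU_dT_comm hR x t v hx]
  exact dT_eq_zero hR h x t v hx

theorem Smooth.dX_dT_dT_eq_zero {R : Set (ℝ × ℝ × ℝ)} {F : ℝ → ℝ → ℝ → ℝ} (hF : Smooth R F)
    (hR : IsOpen R) (h : ∀ x t v, (x, t, v) ∈ R → dX F x t v = 0) :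
    ∀ x t v, (x, t, v) ∈ R → dX (dT (dT F)) x t v = 0 := fun x t v hx => by
  rw [(hF.smooth_dT hR).dX_dT_comm hR x t v hx]
  refine dT_eq_zero hR (fun x t v hx => ?_) x t v hx
  rw [hF.dX_dT_comm hR x t v hx]
  exact dT_eq_zero hR h x t v hx

theorem dX_iterate_succ_eq_zero {R : Set (ℝ × ℝ × ℝ)} {F : ℝ → ℝ → ℝ → ℝ} (hR : IsOpen R)
    (h : ∀ x t v, (x, t, v) ∈ R → dX F x t v = 0) (i : ℕ) :
    ∀ x t v, (x, t, v) ∈ R → dX^[i + 1] F x t v = 0 := by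
  rw [Function.iterate_succ]
  exact dX_iterate_eq_zero hR h i

/-- The invariance criterion for coefficients that are affine in `u`. -/
theorem VField.IsLieSymmetry.determining_affine (h : V.IsLieSymmetry c f D J)
    (hV : V.SmoothOn D J) (hA : V.IsSemiAffine D J) (hD : IsOpen D) (hJ : IsOpen J)
    (hJc : J.OrdConnected) (hf : ContDiffOn ℝ ∞ f J) {x t v : ℝ} (hx : (x, t, v) ∈ region D J)
    (p₁ p₂ p₄ r₀ r₂ : ℝ) {r₄ : ℝ}
    (hΔ : r₄ = r₂ - r₀ - c * p₄ + (1 + deriv f v) * p₂ + deriv (deriv f) v * p₁ ^ 2) :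
    L24 x (fun y => dT (dT V.η) y t v)
      - (2 * dX (dU (dT (dT V.η))) x t v * p₁ + dU (dT (dT V.η)) x t v * p₂)
      + (4 * dX^[3] (dU (dT (dT V.η))) x t v * p₁ + 6 * dX^[2] (dU (dT (dT V.η))) x t v * p₂
        + dU (dT (dT V.η)) x t v * p₄)
      + (dU V.η x t v - 2 * dT V.τ x t v) * (r₀ - r₂ + r₄)
      + dX^[2] (dU V.η) x t v * (6 * r₂ - r₀) + dX^[4] (dU V.η) x t v * r₀
      + (2 * dX V.ξ x t v - 4 * dX^[3] V.ξ x t v) * r₂ - 4 * dX V.ξ x t v * r₄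
      + c * (dX^[4] V.η x t v + 4 * dX^[3] (dU V.η) x t v * p₁ + 6 * dX^[2] (dU V.η) x t v * p₂
        + dU V.η x t v * p₄
        - (dX^[4] V.ξ x t v * p₁ + 4 * dX^[3] V.ξ x t v * p₂ + 4 * dX V.ξ x t v * p₄))
      - (1 + deriv f v) * (dX^[2] V.η x t v + 2 * dX (dU V.η) x t v * p₁ + dU V.η x t v * p₂
        - (dX^[2] V.ξ x t v * p₁ + 2 * dX V.ξ x t v * p₂))
      - deriv (deriv f) v * V.η x t v * p₂
      - 2 * deriv (deriv f) v * p₁ * (dX V.η x t v + dU V.η x t v * p₁ - dX V.ξ x t v * p₁)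
      - deriv (deriv (deriv f)) v * V.η x t v * p₁ ^ 2 = 0 := by
  have hR := isOpen_region hD hJ
  have hSξ : Smooth (region D J) V.ξ := hV.1
  have hSτ : Smooth (region D J) V.τ := hV.2.1
  have hSη : Smooth (region D J) V.η := hV.2.2
  have key := h.determining_taylor hV hD hJ hf hx.1 hx.2 contDiff_const_zero contDiff_const_zero
    p₁ p₂ p₄ r₀ r₂ 0 hΔ
  simp only at key
  set p := taylor x v p₁ p₂ 0 p₄ 0 with hp
  set p' := taylor x p₁ p₂ 0 p₄ 0 0 with hp'
  set w := taylor x 0 p₁ p₂ 0 p₄ 0 with hw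
  set r := taylor x r₀ 0 r₂ 0 r₄ 0 with hr
  set r' := taylor x 0 r₂ 0 r₄ 0 0 with hr'
  have hpv : p x = v := taylor_self
  have hpc : ContDiff ℝ ∞ p := contDiff_taylor
  have hx' : (x, t, p x) ∈ region D J := by rwa [hpv]
  have hdp : deriv p = p' := deriv_taylor
  have hdr : deriv r = r' := deriv_taylor
  have hpw : ∀ y, p y - v = w y := fun y => by
    simp only [hp, hw, taylor]
    ring
  have hs : ∀ {F}, Smooth (region D J) F → ContDiffAt ℝ ∞ (fun y => F y t v) x :=
    fun hF => hF.contDiffAt_x hR (p := fun _ => v) contDiff_const hx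
  have hc : Continuous (fun y => (y, t, p y)) := by
    have := hpc.continuous
    fun_prop
  have hev : ∀ᶠ y in nhds x, (y, t, p y) ∈ region D J :=
    hc.continuousAt.preimage_mem_nhds (hR.mem_nhds hx')
  have hT := hSη.dU_dU_dT_eq_zero hR hA.dU_dU_η
  have hTT := (hSη.smooth_dT hR).dU_dU_dT_eq_zero hR hT
  have hSTT := (hSη.smooth_dT hR).smooth_dT hR
  -- Near x, affinity in u lets every coefficient be frozen at u = v: η becomes its value at v plus
  -- w η_u with w = p - v. What remains are products of functions of y with polynomials, ready for
  -- Leibniz.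
  have e2 : V.char₂ t p 0 r 0 =ᶠ[nhds x] fun y => dT (dT V.η) y t v
      + dU (dT (dT V.η)) y t v * w y + dU V.η y t v * r y
      - (dT V.τ y t v * r y + dT V.τ y t v * r y) - V.ξ y t v * r' y := by
    filter_upwards [hev] with y hy
    simp only [VField.char₂, dt₁, dt₂, Pi.zero_apply, hdr,
      hSTT.eq_affine hD hJ hJc hTT hy.1 hx.2 hy.2, hpw,
      (hSη.smooth_dU hR).eq_of_dU_eq_zero hD hJ hJc hA.dU_dU_η hy.1 hx.2 hy.2,
      hA.dU_ξ _ _ _ hy, dT_eq_zero hR hA.dT_ξ _ _ _ hy, hA.dT_ξ _ _ _ hy,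
      (hSτ.smooth_dT hR).eq_of_dU_eq_zero hD hJ hJc (fun x t v h => by
        rw [hSτ.dU_dT_comm hR x t v h, dT_eq_zero hR hA.dU_τ x t v h]) hy.1 hx.2 hy.2,
      hSξ.eq_of_dU_eq_zero hD hJ hJc hA.dU_ξ hy.1 hx.2 hy.2]
    ring
  have e0 : V.char₀ t p 0 =ᶠ[nhds x] fun y => V.η y t v + dU V.η y t v * w y
      - V.ξ y t v * p' y := by
    filter_upwards [hev] with y hy
    simp only [VField.char₀, Pi.zero_apply, hdp, hSη.eq_affine hD hJ hJc hA.dU_dU_η hy.1 hx.2 hy.2,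
      hpw, hSξ.eq_of_dU_eq_zero hD hJ hJc hA.dU_ξ hy.1 hx.2 hy.2]
    ring
  have cw : ContDiffAt ℝ ∞ w x := contDiff_taylor.contDiffAt
  have cp' : ContDiffAt ℝ ∞ p' x := contDiff_taylor.contDiffAt
  have cr : ContDiffAt ℝ ∞ r x := contDiff_taylor.contDiffAt
  have cr' : ContDiffAt ℝ ∞ r' x := contDiff_taylor.contDiffAt
  have cX := hs hSξ
  have cA := hs (hSη.smooth_dU hR)
  have cB := hs (hSτ.smooth_dT hR)
  have cη := hs hSη
  have cH := hs hSTT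
  have cK := hs (hSTT.smooth_dU hR)
  -- Since τ_t does not depend on x, only its undifferentiated Leibniz terms survive.
  have hB : ∀ i, iteratedDeriv (i + 1) (fun y => dT V.τ y t v) x = 0 := fun i => by
    rw [iteratedDeriv_eq_dX_iterate]
    refine dX_iterate_succ_eq_zero hR (fun x t v h => ?_) i x t v hx
    rw [hSτ.dX_dT_comm hR x t v h]
    exact dT_eq_zero hR hA.dX_τ x t v h
  have hchar₂ : L24 x (V.char₂ t p 0 r 0) = L24 x (fun y => dT (dT V.η) y t v)
      + L24 x (fun y => dU (dT (dT V.η)) y t v * w y) + L24 x (fun y => dU V.η y t v * r y)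
      - (L24 x (fun y => dT V.τ y t v * r y) + L24 x (fun y => dT V.τ y t v * r y))
      - L24 x (fun y => V.ξ y t v * r' y) := by
    rw [L24_congr e2, L24_sub (((cH.add (cK.mul cw)).add (cA.mul cr)).sub
      ((cB.mul cr).add (cB.mul cr))) (cX.mul cr'), L24_sub ((cH.add (cK.mul cw)).add (cA.mul cr))
      ((cB.mul cr).add (cB.mul cr)), L24_add (cH.add (cK.mul cw)) (cA.mul cr),
      L24_add cH (cK.mul cw), L24_add (cB.mul cr) (cB.mul cr)]
  have hchar₀ : ∀ i, iteratedDeriv i (V.char₀ t p 0) x = iteratedDeriv i (fun y => V.η y t v) x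
      + iteratedDeriv i (fun y => dU V.η y t v * w y) x
      - iteratedDeriv i (fun y => V.ξ y t v * p' y) x := fun i => by
    rw [e0.iteratedDeriv_eq, iteratedDeriv_sub_of_smooth i (cη.add (cA.mul cw)) (cX.mul cp'),
      iteratedDeriv_add_of_smooth i cη (cA.mul cw)]
  have h00 : ∀ i, iteratedDeriv i (0 : ℝ → ℝ) x = 0 := fun i => by
    change iteratedDeriv i (fun _ => 0) x = 0
    simp
  have hL0 : L24 x (0 : ℝ → ℝ) = 0 := by simp [L24, h00]
  rw [hchar₂, hw, hr, hr', L24_mul_taylor cK, L24_mul_taylor cA, L24_mul_taylor cB,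
    L24_mul_taylor cX, hB 1, hB 3, hB 0, hB 2, hchar₀, hchar₀, hchar₀, hw, hp',
    iteratedDeriv_four_mul_taylor cA, iteratedDeriv_four_mul_taylor cX,
    iteratedDeriv_two_mul_taylor cA, iteratedDeriv_two_mul_taylor cX,
    iteratedDeriv_one_mul_taylor cA, iteratedDeriv_one_mul_taylor cX, h00, h00, h00, hL0] at key
  simp only [iteratedDeriv_eq_dX_iterate, Function.iterate_one] at key
  linear_combination key

end

/-! ### Solving the remaining determining equations -/

section

variable {V : VField} {D : Set (ℝ × ℝ)} {J : Set ℝ} {c : ℝ} {f : ℝ → ℝ}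

theorem dX_iterate_eq_mul {R : Set (ℝ × ℝ × ℝ)} {F G : ℝ → ℝ → ℝ → ℝ} (hR : IsOpen R) {a : ℝ}
    (h : ∀ x t v, (x, t, v) ∈ R → F x t v = a * G x t v) (i : ℕ) :
    ∀ x t v, (x, t, v) ∈ R → dX^[i] F x t v = a * dX^[i] G x t v := by
  induction i with
  | zero => exact h
  | succ i ih =>
    intro x t v hx
    rw [Function.iterate_succ_apply', Function.iterate_succ_apply', dX_congr hR ih x t v hx]
    simp [dX, deriv_const_mul_field]

/-- The coefficients of u_xxtt and u_tt, with u_xxxxtt eliminated, are 6η_uxx - 4ξ_xxx - 2ξ_x = 0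
and η_uxxxx - η_uxx + 4ξ_x = 0. Substituting η_ux = (3/2)ξ_xx turns both into constant-coefficient
ODEs for ξ, and these are incompatible unless ξ_x = 0. -/
theorem VField.IsLieSymmetry.dX_ξ (h : V.IsLieSymmetry c f D J) (hV : V.SmoothOn D J)
    (hD : IsOpen D) (hJ : IsOpen J) (hJc : J.OrdConnected) (hf : ContDiffOn ℝ ∞ f J) :
    ∀ x t v, (x, t, v) ∈ region D J → dX V.ξ x t v = 0 := by
  have hR := isOpen_region hD hJ
  have hA := h.isSemiAffine hV hD hJ hf
  have hM : ∀ x t v, (x, t, v) ∈ region D J → dX (dU V.η) x t v = 3 / 2 * dX^[2] V.ξ x t v :=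
    fun x t v hx => by
      change _ = 3 / 2 * dX (dX V.ξ) x t v
      linear_combination hA.dX_dU_η x t v hx / 2
  have hM2 : ∀ x t v, (x, t, v) ∈ region D J → dX^[2] (dU V.η) x t v = 3 / 2 * dX^[3] V.ξ x t v :=
    dX_iterate_eq_mul hR hM 1
  have hM4 : ∀ x t v, (x, t, v) ∈ region D J → dX^[4] (dU V.η) x t v = 3 / 2 * dX^[5] V.ξ x t v :=
    dX_iterate_eq_mul hR hM 3
  have h3 : ∀ x t v, (x, t, v) ∈ region D J → dX^[3] V.ξ x t v = 2 / 5 * dX V.ξ x t v :=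
    fun x t v hx => by
      have a := h.determining_affine hV hA hD hJ hJc hf hx 0 0 0 0 0 (r₄ := 0) (by ring)
      have b := h.determining_affine hV hA hD hJ hJc hf hx 0 0 0 0 1 (r₄ := 1) (by ring)
      linear_combination (b - a) / 5 - 6 / 5 * hM2 x t v hx
  have h5 : ∀ x t v, (x, t, v) ∈ region D J → dX^[5] V.ξ x t v = 2 / 5 * dX^[3] V.ξ x t v :=
    dX_iterate_eq_mul hR h3 2
  intro x t v hx
  have a := h.determining_affine hV hA hD hJ hJc hf hx 0 0 0 0 0 (r₄ := 0) (by ring)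
  have b := h.determining_affine hV hA hD hJ hJc hf hx 0 0 0 1 0 (r₄ := -1) (by ring)
  -- With ξ_xxx = (2/5)ξ_x and hence ∂_x⁵ξ = (4/25)ξ_x, the second ODE reads (4 - 3/5 + 6/25)ξ_x =
  -- (91/25)ξ_x = 0.
  linear_combination (25 / 91) * (b - a + hM2 x t v hx - hM4 x t v hx
    - 3 / 2 * h5 x t v hx + (3 / 2 - 3 / 5) * h3 x t v hx)

/-- A nonlinear function has a point with nonvanishing second derivative. -/
theorem IsNonlinear.exists_deriv_deriv_ne_zero (hJ : IsOpen J) (hJc : J.OrdConnected)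
    (hf : IsNonlinear f J) : ∃ v ∈ J, deriv (deriv f) v ≠ 0 := by
  by_contra! hcon
  apply hf.2
  have hJp : IsPreconnected J := hJc.isPreconnected
  have hd : ∀ {g : ℝ → ℝ}, ContDiffOn ℝ ∞ g J → ∀ u ∈ J, HasDerivAt g (deriv g u) u :=
    fun hg u hu => ((hg.contDiffAt (hJ.mem_nhds hu)).differentiableAt (by simp)).hasDerivAt
  have hf1 : ContDiffOn ℝ ∞ (deriv f) J := hf.1.deriv_of_isOpen hJ (by simp)
  rcases J.eq_empty_or_nonempty with rfl | ⟨v, hv⟩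
  · exact ⟨0, 0, by simp⟩
  have h1 : ∀ u ∈ J, deriv f u = deriv f v := fun u hu =>
    hJ.is_const_of_deriv_eq_zero hJp
      (fun u hu => (hd hf1 u hu).differentiableAt.differentiableWithinAt) hcon hu hv
  have h2 : ∀ u ∈ J, HasDerivAt (fun u => f u - u * deriv f v) 0 u := fun u hu => by
    have := (hd hf.1 u hu).sub ((hasDerivAt_id u).mul_const (deriv f v))
    rw [h1 u hu, one_mul, sub_self] at this
    exact this
  refine ⟨deriv f v, f v - v * deriv f v, fun u hu => ?_⟩
  have h3 := hJ.is_const_of_deriv_eq_zero hJp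
    (fun u hu => (h2 u hu).differentiableAt.differentiableWithinAt)
    (fun u hu => (h2 u hu).deriv) hu hv
  linear_combination h3

theorem dX_iterate_dU_η_eq_zero (hR : IsOpen (region D J)) (hA : V.IsSemiAffine D J)
    (hX : ∀ x t v, (x, t, v) ∈ region D J → dX V.ξ x t v = 0) (i : ℕ) :
    ∀ x t v, (x, t, v) ∈ region D J → dX^[i + 1] (dU V.η) x t v = 0 :=
  dX_iterate_succ_eq_zero hR (fun x t v hx => by
    have := hA.dX_dU_η x t v hx
    rw [dX_eq_zero hR hX x t v hx] at this
    linear_combination this / 2) i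

/-- Nonlinearity enters here: at a point w with f''(w) ≠ 0 the part of the criterion odd in u_x
reduces to f''(w) η_x = 0. Because η_xu = 0, vanishing at w spreads to all of `J`. -/
theorem VField.IsLieSymmetry.dX_η (h : V.IsLieSymmetry c f D J) (hV : V.SmoothOn D J)
    (hD : IsOpen D) (hJ : IsOpen J) (hJc : J.OrdConnected) (hf : IsNonlinear f J) :
    ∀ x t v, (x, t, v) ∈ region D J → dX V.η x t v = 0 := by
  have hR := isOpen_region hD hJ
  have hA := h.isSemiAffine hV hD hJ hf.1
  have hX := h.dX_ξ hV hD hJ hJc hf.1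
  obtain ⟨w, hw, hw2⟩ := hf.exists_deriv_deriv_ne_zero hJ hJc
  have hSη : Smooth (region D J) V.η := hV.2.2
  intro x t v hx
  have hxw : (x, t, w) ∈ region D J := ⟨hx.1, hw⟩
  -- Jets with u_x = 1 and u_x = -1 have the same u_xxxxtt; subtracting them cancels every term even
  -- in u_x, including those with f'''.
  have b := h.determining_affine hV hA hD hJ hJc hf.1 hxw 1 0 0 0 0 (r₄ := deriv (deriv f) w)
    (by ring)
  have b' := h.determining_affine hV hA hD hJ hJc hf.1 hxw (-1) 0 0 0 0
    (r₄ := deriv (deriv f) w) (by ring)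
  have hM := dX_iterate_dU_η_eq_zero hR hA hX
  have hK1 : ∀ x t v, (x, t, v) ∈ region D J → dX (dU (dT (dT V.η))) x t v = 0 := by
    intro x t v hx
    rw [dX_congr hR (G := dT (dT (dU V.η))) (fun x t v hx => ?_) x t v hx]
    · exact (hSη.smooth_dU hR).dX_dT_dT_eq_zero hR (hM 0) x t v hx
    · rw [(hSη.smooth_dT hR).dU_dT_comm hR x t v hx]
      exact dT_congr hR (hSη.dU_dT_comm hR) x t v hx
  have hK3 := dX_iterate_succ_eq_zero hR hK1 2 x t w hxw
  have hX2 := dX_iterate_succ_eq_zero hR hX 1 x t w hxw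
  have hX4 := dX_iterate_succ_eq_zero hR hX 3 x t w hxw
  have hM1 : dX (dU V.η) x t w = 0 := hM 0 x t w hxw
  simp only [Nat.reduceAdd] at hK3 hX2 hX4
  have hw0 : deriv (deriv f) w * dX V.η x t w = 0 := by
    linear_combination (b' - b) / 4 - hK1 x t w hxw + 2 * hK3 + c * 2 * hM 2 x t w hxw
      - c / 2 * hX4 - (1 + deriv f w) * hM1 + (1 + deriv f w) / 2 * hX2
  have hw1 : dX V.η x t w = 0 := (mul_eq_zero.1 hw0).resolve_left hw2
  rw [(hSη.smooth_dX hR).eq_of_dU_eq_zero hD hJ hJc (fun x t v hx => by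
    rw [hSη.dU_dX_comm hR x t v hx]
    exact hM 0 x t v hx) hx.1 hw hx.2, hw1]

/-- At the jet with all derivatives zero the criterion says that η solves the equation linearized at
the constant v; with η_x = 0 only η_tt is left. -/
theorem VField.IsLieSymmetry.dT_dT_η (h : V.IsLieSymmetry c f D J) (hV : V.SmoothOn D J)
    (hD : IsOpen D) (hJ : IsOpen J) (hJc : J.OrdConnected) (hf : IsNonlinear f J) :
    ∀ x t v, (x, t, v) ∈ region D J → dT (dT V.η) x t v = 0 := by
  have hR := isOpen_region hD hJ
  have hA := h.isSemiAffine hV hD hJ hf.1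
  have hSη : Smooth (region D J) V.η := hV.2.2
  have hX := h.dX_η hV hD hJ hJc hf
  have hX2 := hSη.dX_dT_dT_eq_zero hR hX
  intro x t v hx
  have a := h.determining_affine hV hA hD hJ hJc hf.1 hx 0 0 0 0 0 (r₄ := 0) (by ring)
  rw [L24, iteratedDeriv_eq_dX_iterate, iteratedDeriv_eq_dX_iterate,
    dX_iterate_succ_eq_zero hR hX2 1 x t v hx, dX_iterate_succ_eq_zero hR hX2 3 x t v hx,
    dX_iterate_succ_eq_zero hR hX 1 x t v hx, dX_iterate_succ_eq_zero hR hX 3 x t v hx] at a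
  linear_combination a

/-- The remaining equations: `τ` is constant if `c ≠ 0`, and the classifying equation. -/
theorem VField.IsLieSymmetry.classifying (h : V.IsLieSymmetry c f D J) (hV : V.SmoothOn D J)
    (hD : IsOpen D) (hJ : IsOpen J) (hJc : J.OrdConnected) (hf : IsNonlinear f J) {x t v : ℝ}
    (hx : (x, t, v) ∈ region D J) :
    c * dT V.τ x t v = 0 ∧
      2 * dT V.τ x t v * (1 + deriv f v) + deriv (deriv f) v * V.η x t v = 0 := by
  have hR := isOpen_region hD hJ
  have hA := h.isSemiAffine hV hD hJ hf.1
  have hX := h.dX_ξ hV hD hJ hJc hf.1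
  have hM := dX_iterate_dU_η_eq_zero hR hA hX
  have hK := dU_eq_zero hR (h.dT_dT_η hV hD hJ hJc hf)
  -- The zero jet, then u_xxxx = 1, then u_xx = 1, each with the u_xxxxtt that Δ = 0 requires. In
  -- the last two the η_u and ξ_x contributions cancel, apart from terms already known to vanish.
  have a := h.determining_affine hV hA hD hJ hJc hf.1 hx 0 0 0 0 0 (r₄ := 0) (by ring)
  have b := h.determining_affine hV hA hD hJ hJc hf.1 hx 0 0 1 0 0 (r₄ := -c) (by ring)
  have d := h.determining_affine hV hA hD hJ hJc hf.1 hx 0 1 0 0 0 (r₄ := 1 + deriv f v) (by ring)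
  have hK2 := dX_iterate_eq_zero hR hK 2 x t v hx
  have hX3 := dX_iterate_succ_eq_zero hR hX 2 x t v hx
  have hM2 := hM 1 x t v hx
  simp only [Nat.reduceAdd] at hX3 hM2
  constructor
  · linear_combination (b - a - hK x t v hx) / 2
  · linear_combination a - d - hK x t v hx + 6 * hK2 + c * 6 * hM2 - c * 4 * hX3
      - 2 * (1 + deriv f v) * hX x t v hx

theorem Smooth.exists_const {F : ℝ → ℝ → ℝ → ℝ} (hF : Smooth (region D J) F) (hD : IsOpen D)
    (hDc : IsConnected D) (hJ : IsOpen J) (hJc : J.OrdConnected)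
    (hX : ∀ x t v, (x, t, v) ∈ region D J → dX F x t v = 0)
    (hT : ∀ x t v, (x, t, v) ∈ region D J → dT F x t v = 0)
    (hU : ∀ x t v, (x, t, v) ∈ region D J → dU F x t v = 0) :
    ∃ a, ∀ x t v, (x, t, v) ∈ region D J → F x t v = a := by
  have hR := isOpen_region hD hJ
  have hRp : IsPreconnected (region D J) := by
    have h1 := (hDc.isPreconnected.prod hJc.isPreconnected).image
      (fun p : (ℝ × ℝ) × ℝ => (p.1.1, p.1.2, p.2)) (by fun_prop)
    convert h1 using 1
    ext ⟨x, t, v⟩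
    constructor
    · rintro ⟨h1, h2⟩
      exact ⟨((x, t), v), ⟨h1, h2⟩, rfl⟩
    · rintro ⟨⟨⟨x', t'⟩, v'⟩, ⟨h1, h2⟩, he⟩
      simp only [Prod.mk.injEq] at he
      obtain ⟨rfl, rfl, rfl⟩ := he
      exact ⟨h1, h2⟩
  obtain ⟨a, ha⟩ := hR.exists_is_const_of_fderiv_eq_zero (𝕜 := ℝ) hRp
    (ContDiffOn.differentiableOn hF (by simp)) (fun ⟨x, t, v⟩ hx => by
      ext
      · exact (hF.dX_eq hR hx).symm.trans (hX x t v hx)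
      · exact (hF.dT_eq hR hx).symm.trans (hT x t v hx)
      · exact (hF.dU_eq hR hx).symm.trans (hU x t v hx))
  exact ⟨a, fun x t v hx => ha (x, t, v) hx⟩

theorem VField.IsLieSymmetry.exists_isTranslation (h : V.IsLieSymmetry c f D J)
    (hV : V.SmoothOn D J) (hD : IsOpen D) (hDc : IsConnected D) (hJ : IsOpen J)
    (hJc : J.OrdConnected) (hf : IsNonlinear f J)
    (hτ : ∀ x t v, (x, t, v) ∈ region D J → dT V.τ x t v = 0)
    (hη : ∀ x t v, (x, t, v) ∈ region D J → V.η x t v = 0) :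
    ∃ l m : ℝ, V.IsTranslation D J l m := by
  have hA := h.isSemiAffine hV hD hJ hf.1
  obtain ⟨l, hl⟩ := Smooth.exists_const hV.1 hD hDc hJ hJc (h.dX_ξ hV hD hJ hJc hf.1) hA.dT_ξ
    hA.dU_ξ
  obtain ⟨m, hm⟩ := Smooth.exists_const hV.2.1 hD hDc hJ hJc hA.dX_τ hτ hA.dU_τ
  exact ⟨l, m, fun x t u hx hu => ⟨hl x t u ⟨hx, hu⟩, hm x t u ⟨hx, hu⟩, hη x t u ⟨hx, hu⟩⟩⟩

/-- The hypothesis c ≠ 0 is what removes τ_t. For c = 0 the classifying equation can have other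
solutions: with f = u² - u it allows η = -2τ_t u, the scaling symmetry. -/
theorem VField.IsLieSymmetry.isTranslation_of_ne_zero (h : V.IsLieSymmetry c f D J) (hc : c ≠ 0)
    (hV : V.SmoothOn D J) (hD : IsOpen D) (hDc : IsConnected D) (hJ : IsOpen J)
    (hJc : J.OrdConnected) (hf : IsNonlinear f J) : ∃ l m : ℝ, V.IsTranslation D J l m := by
  have hA := h.isSemiAffine hV hD hJ hf.1
  have hτ : ∀ x t v, (x, t, v) ∈ region D J → dT V.τ x t v = 0 := fun x t v hx =>
    (mul_eq_zero.1 (h.classifying hV hD hJ hJc hf hx).1).resolve_left hc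
  refine h.exists_isTranslation hV hD hDc hJ hJc hf hτ ?_
  obtain ⟨w, hw, hw2⟩ := hf.exists_deriv_deriv_ne_zero hJ hJc
  have hf2 : ContinuousOn (deriv (deriv f)) J :=
    ((hf.1.deriv_of_isOpen hJ (m := ∞) (by simp)).deriv_of_isOpen hJ (m := ∞)
      (by simp)).continuousOn
  have hO : IsOpen (J ∩ deriv (deriv f) ⁻¹' {0}ᶜ) :=
    hf2.isOpen_inter_preimage hJ isOpen_compl_singleton
  -- A function affine in u is determined by two values, so a second zero w' of η is taken from the
  -- open set where f'' ≠ 0.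
  obtain ⟨w', hw', hne⟩ := exists_ne_mem hO ⟨hw, hw2⟩
  have hη0 : ∀ u ∈ J ∩ deriv (deriv f) ⁻¹' {0}ᶜ, ∀ x t, (x, t) ∈ D → V.η x t u = 0 := by
    intro u hu x t hx
    have h1 := (h.classifying hV hD hJ hJc hf (x := x) (t := t) (v := u) ⟨hx, hu.1⟩).2
    rw [hτ x t u ⟨hx, hu.1⟩] at h1
    have h2 : deriv (deriv f) u * V.η x t u = 0 := by linear_combination h1
    exact (mul_eq_zero.1 h2).resolve_left hu.2
  intro x t v hx
  have e : ∀ u ∈ J, V.η x t u = V.η x t w + (u - w) * dU V.η x t w := fun u hu =>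
    Smooth.eq_affine hV.2.2 hD hJ hJc hA.dU_dU_η hx.1 hw hu
  have e1 := e w' hw'.1
  rw [hη0 w ⟨hw, hw2⟩ x t hx.1, hη0 w' hw' x t hx.1, zero_add] at e1
  have e2 : dU V.η x t w = 0 := (mul_eq_zero.1 e1.symm).resolve_left (sub_ne_zero.2 hne)
  rw [e v hx.2, e2, hη0 w ⟨hw, hw2⟩ x t hx.1]
  ring

theorem isNonlinear_sq (hJ : IsOpen J) (hne : J.Nonempty) {a : ℝ} (ha : a ≠ 0) :
    IsNonlinear (fun u => a * u ^ 2) J := by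
  refine ⟨by fun_prop, ?_⟩
  rintro ⟨b, d, h⟩
  obtain ⟨v, hv⟩ := hne
  obtain ⟨w, hw, hwv⟩ := exists_ne_mem hJ hv
  obtain ⟨z, ⟨hz, hzw⟩, hzv⟩ := exists_ne_mem (hJ.inter (isOpen_compl_singleton (x := w)))
    ⟨hv, fun e => hwv e.symm⟩
  have h1 := h v hv
  have h2 := h w hw
  have h3 := h z hz
  have h4 : w - v ≠ 0 := sub_ne_zero.2 hwv
  have h5 : z - v ≠ 0 := sub_ne_zero.2 hzv
  have h6 : z - w ≠ 0 := sub_ne_zero.2 hzw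
  -- Second divided difference at three distinct points: it vanishes for an affine function but
  -- equals a for a u².
  refine mul_ne_zero (mul_ne_zero ha h4) (mul_ne_zero h5 h6) ?_
  linear_combination (w - v) * (h3 - h1) - (z - v) * (h2 - h1)

/-- Two test nonlinearities suffice. For u² and 2u² the classifying equations are 2τ_t(1 + 2u) + 2η
= 0 and 2τ_t(1 + 4u) + 4η = 0; the first minus half the second is τ_t = 0, and then η = 0. -/
theorem isTranslation_of_forall (hV : V.SmoothOn D J) (hD : IsOpen D) (hDc : IsConnected D)
    (hJ : IsOpen J) (hJc : J.OrdConnected)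
    (h : ∀ f : ℝ → ℝ, IsNonlinear f J → V.IsLieSymmetry c f D J) :
    ∃ l m : ℝ, V.IsTranslation D J l m := by
  rcases J.eq_empty_or_nonempty with rfl | hne
  -- Over an empty `J` the translation condition is vacuous, so any constants will do.
  · exact ⟨0, 0, fun _ _ _ _ hu => hu.elim⟩
  have hn1 := isNonlinear_sq hJ hne (a := 1) one_ne_zero
  have hn2 := isNonlinear_sq hJ hne (a := 2) two_ne_zero
  have hd : ∀ a : ℝ, deriv (fun u : ℝ => a * u ^ 2) = fun u => 2 * a * u := fun a => by
    funext u
    refine (((hasDerivAt_id u).pow 2).const_mul a).deriv.trans ?_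
    simp
    ring
  have hdd : ∀ a u : ℝ, deriv (fun u : ℝ => 2 * a * u) u = 2 * a := fun a u => by
    simp
  have key : ∀ x t v, (x, t, v) ∈ region D J → dT V.τ x t v = 0 ∧ V.η x t v = 0 := by
    intro x t v hx
    have h1 := ((h _ hn1).classifying hV hD hJ hJc hn1 hx).2
    have h2 := ((h _ hn2).classifying hV hD hJ hJc hn2 hx).2
    rw [hd, hdd] at h1 h2
    have hτ : dT V.τ x t v = 0 := by linear_combination h1 - h2 / 2
    refine ⟨hτ, ?_⟩
    rw [hτ] at h1
    linear_combination h1 / 2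
  exact (h _ hn1).exists_isTranslation hV hD hDc hJ hJc hn1 (fun x t v hx => (key x t v hx).1)
    fun x t v hx => (key x t v hx).2

end

/-! ### Translations are symmetries -/

section

variable {u v : ℝ → ℝ → ℝ}

theorem Dx_congr {O : Set (ℝ × ℝ)} (hO : IsOpen O) (h : ∀ x t, (x, t) ∈ O → u x t = v x t) :
    ∀ x t, (x, t) ∈ O → Dx u x t = Dx v x t := fun x t hx =>
  Filter.EventuallyEq.deriv_eq <| by
    have hc : Continuous (fun s : ℝ => (s, t)) := by fun_prop
    filter_upwards [hc.continuousAt.preimage_mem_nhds (hO.mem_nhds hx)] with s hs using h s t hs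

theorem Dt_congr {O : Set (ℝ × ℝ)} (hO : IsOpen O) (h : ∀ x t, (x, t) ∈ O → u x t = v x t) :
    ∀ x t, (x, t) ∈ O → Dt u x t = Dt v x t := fun x t hx =>
  Filter.EventuallyEq.deriv_eq <| by
    have hc : Continuous (fun s : ℝ => (x, s)) := by fun_prop
    filter_upwards [hc.continuousAt.preimage_mem_nhds (hO.mem_nhds hx)] with s hs using h x s hs

theorem pd_congr {O : Set (ℝ × ℝ)} (hO : IsOpen O) (h : ∀ x t, (x, t) ∈ O → u x t = v x t)
    (i j : ℕ) : ∀ x t, (x, t) ∈ O → pd i j u x t = pd i j v x t := by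
  have hj : ∀ x t, (x, t) ∈ O → Dt^[j] u x t = Dt^[j] v x t := by
    induction j with
    | zero => exact h
    | succ j ih =>
      simp only [Function.iterate_succ']
      exact Dt_congr hO ih
  induction i with
  | zero => exact hj
  | succ i ih =>
    simp only [pd, Function.iterate_succ']
    exact Dx_congr hO ih

/-- `u (x, t)` is smooth on the whole plane. -/
def SmoothPlane (u : ℝ → ℝ → ℝ) : Prop := Smooth Set.univ (fun x t _ => u x t)

theorem smoothPlane_of_contDiff (hu : ContDiff ℝ ∞ (fun p : ℝ × ℝ => u p.1 p.2)) :
    SmoothPlane u :=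
  (hu.comp (by fun_prop : ContDiff ℝ ∞ (fun p : ℝ × ℝ × ℝ => (p.1, p.2.1)))).contDiffOn

theorem SmoothPlane.Dx (hu : SmoothPlane u) : SmoothPlane (Dx u) := Smooth.smooth_dX hu isOpen_univ

theorem SmoothPlane.Dt (hu : SmoothPlane u) : SmoothPlane (Dt u) := Smooth.smooth_dT hu isOpen_univ

theorem SmoothPlane.Dt_iterate (hu : SmoothPlane u) (j : ℕ) :
    SmoothPlane (Boussinesq.Dt^[j] u) := by
  induction j with
  | zero => exact hu
  | succ j ih =>
    rw [Function.iterate_succ_apply']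
    exact ih.Dt

theorem SmoothPlane.comm (hu : SmoothPlane u) :
    Boussinesq.Dt (Boussinesq.Dx u) = Boussinesq.Dx (Boussinesq.Dt u) := by
  funext x t
  exact (Smooth.dX_dT_comm hu isOpen_univ x t 0 (Set.mem_univ _)).symm

theorem SmoothPlane.differentiableAt_x (hu : SmoothPlane u) (x t : ℝ) :
    DifferentiableAt ℝ (fun s => u s t) x :=
  (Smooth.contDiffAt_x hu isOpen_univ (p := fun _ => 0) contDiff_const
    (Set.mem_univ _)).differentiableAt (by simp)

theorem SmoothPlane.differentiableAt_t (hu : SmoothPlane u) (x t : ℝ) :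
    DifferentiableAt ℝ (fun s => u x s) t :=
  (Smooth.contDiffAt_comp hu isOpen_univ (a := fun _ => x) (b := id) (v := fun _ => 0)
    (Set.mem_univ _) contDiffAt_const contDiffAt_id contDiffAt_const).differentiableAt (by simp)

theorem SmoothPlane.Dt_iterate_Dx (hu : SmoothPlane u) (j : ℕ) :
    Boussinesq.Dt^[j] (Boussinesq.Dx u) = Boussinesq.Dx (Boussinesq.Dt^[j] u) := by
  induction j with
  | zero => rfl
  | succ j ih =>
    rw [Function.iterate_succ_apply', ih, (hu.Dt_iterate j).comm, Function.iterate_succ_apply']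

theorem SmoothPlane.pd_linear (hu : SmoothPlane u) (hv : SmoothPlane v) (a b : ℝ) (i j : ℕ) :
    pd i j (fun x t => a * u x t + b * v x t) = fun x t => a * pd i j u x t + b * pd i j v x t := by
  have hj : Boussinesq.Dt^[j] (fun x t => a * u x t + b * v x t)
      = fun x t => a * Boussinesq.Dt^[j] u x t + b * Boussinesq.Dt^[j] v x t := by
    induction j with
    | zero => rfl
    | succ j ih =>
      simp only [Function.iterate_succ_apply', ih]
      funext x t
      exact ((((hu.Dt_iterate j).differentiableAt_t x t).hasDerivAt.const_mul a).add
        (((hv.Dt_iterate j).differentiableAt_t x t).hasDerivAt.const_mul b)).deriv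
  have hs : ∀ {w} i, SmoothPlane w → SmoothPlane (Boussinesq.Dx^[i] w) := fun {w} i hw => by
    induction i with
    | zero => exact hw
    | succ i ih =>
      rw [Function.iterate_succ_apply']
      exact ih.Dx
  unfold pd
  rw [hj]
  induction i with
  | zero => rfl
  | succ i ih =>
    simp only [Function.iterate_succ_apply', ih]
    funext x t
    exact ((((hs i (hu.Dt_iterate j)).differentiableAt_x x t).hasDerivAt.const_mul a).add
      (((hs i (hv.Dt_iterate j)).differentiableAt_x x t).hasDerivAt.const_mul b)).deriv

/-- The characteristic is -l u_x - m u_t, and its derivatives cancel the terms ξ u_{i+1,j} + τ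
u_{i,j+1} exactly. The prolongation has no u-components at all, so Δ need not vanish at the jet. -/
theorem VField.IsTranslation.isLieSymmetry {V : VField} {D : Set (ℝ × ℝ)} {J : Set ℝ} {l m : ℝ}
    (h : V.IsTranslation D J l m) (hD : IsOpen D) (hJ : IsOpen J) (c : ℝ) (f : ℝ → ℝ) :
    V.IsLieSymmetry c f D J := by
  intro x t hx u hu hux _
  have hus := smoothPlane_of_contDiff hu
  -- `V` is a translation only over D × J, so the formula for the characteristic is used on the open
  -- set where u takes values in `J`.
  set O : Set (ℝ × ℝ) := D ∩ (fun p => u p.1 p.2) ⁻¹' J with hO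
  have hOo : IsOpen O := hD.inter (hJ.preimage hu.continuous)
  have hxO : (x, t) ∈ O := ⟨hx, hux⟩
  have hchar : ∀ y s, (y, s) ∈ O →
      V.characteristic u y s = (fun y s => -l * Dx u y s + -m * Dt u y s) y s := by
    intro y s hy
    obtain ⟨e1, e2, e3⟩ := h y s (u y s) hy.1 hy.2
    simp only [VField.characteristic, e1, e2, e3]
    ring
  have h0 : V.prCoeff u x t = fun _ _ => 0 := by
    funext i j
    obtain ⟨e1, e2, -⟩ := h x t (u x t) hx hux
    have e3 : pd i j (Dx u) = pd (i + 1) j u := by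
      rw [pd, hus.Dt_iterate_Dx, pd, Function.iterate_succ_apply]
    have e4 : pd i j (Dt u) = pd i (j + 1) u := by
      rw [pd, pd, Function.iterate_succ_apply]
    rw [VField.prCoeff, pd_congr hOo hchar i j x t hxO, hus.Dx.pd_linear hus.Dt, e1, e2, e3, e4]
    ring
  simp [VField.prApply, h0]

end

/-! ### Translations act on solutions -/

section

variable {u : ℝ → ℝ → ℝ}

theorem pd_shift (i j : ℕ) (a b : ℝ) :
    pd i j (fun x t => u (x - a) (t - b)) = fun x t => pd i j u (x - a) (t - b) := by
  have hx : ∀ w : ℝ → ℝ → ℝ, Dx (fun x t => w (x - a) (t - b)) = fun x t => Dx w (x - a) (t - b) :=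
    fun w => by
      funext x t
      exact deriv_comp_sub_const (f := fun s => w s (t - b)) a x
  have ht : ∀ w : ℝ → ℝ → ℝ, Dt (fun x t => w (x - a) (t - b)) = fun x t => Dt w (x - a) (t - b) :=
    fun w => by
      funext x t
      exact deriv_comp_sub_const (f := fun s => w (x - a) s) b t
  have hj : Dt^[j] (fun x t => u (x - a) (t - b)) = fun x t => Dt^[j] u (x - a) (t - b) := by
    induction j with
    | zero => rfl
    | succ j ih => simp only [Function.iterate_succ_apply', ih, ht]
  unfold pd
  rw [hj]
  induction i with
  | zero => rfl
  | succ i ih => simp only [Function.iterate_succ_apply', ih, hx]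

theorem IsSolutionOn.shift {c : ℝ} {f : ℝ → ℝ} {J : Set ℝ} {U : Set (ℝ × ℝ)}
    (h : IsSolutionOn c f J U u) (a b : ℝ) :
    IsSolutionOn c f J {p | (p.1 - a, p.2 - b) ∈ U} (fun x t => u (x - a) (t - b)) := by
  refine ⟨h.1.comp (f := fun p : ℝ × ℝ => (p.1 - a, p.2 - b)) (by fun_prop) fun _ hp => hp,
    fun x t hx => ⟨(h.2 _ _ hx).1, ?_⟩⟩
  have e := (h.2 _ _ hx).2
  rw [pd_shift (u := fun x t => f (u x t))]
  simpa only [pd_shift] using e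

end

/-! ### Traveling waves -/

section

variable {l m : ℝ} {U : Set (ℝ × ℝ)} {u : ℝ → ℝ → ℝ} {h : ℝ → ℝ} {Z : Set ℝ}

/-- On an open set `iteratedDeriv` agrees with `iteratedDerivWithin`, whose differentiability
`ContDiffOn` controls. -/
theorem hasDerivAt_iteratedDeriv {n k : ℕ} (hZ : IsOpen Z) (hh : ContDiffOn ℝ n h Z) (hk : k < n)
    {z : ℝ} (hz : z ∈ Z) : HasDerivAt (iteratedDeriv k h) (iteratedDeriv (k + 1) h z) z := by
  rw [iteratedDeriv_succ]
  have h1 := hh.differentiableOn_iteratedDerivWithin (m := k) (by exact_mod_cast hk)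
    hZ.uniqueDiffOn
  have h2 : DifferentiableOn ℝ (iteratedDeriv k h) Z :=
    h1.congr fun y hy => (iteratedDerivWithin_of_isOpen hZ hy).symm
  exact (h2.differentiableAt (hZ.mem_nhds hz)).hasDerivAt

theorem pd_wave {n : ℕ} (hU : IsOpen U) (hZ : IsOpen Z) (hh : ContDiffOn ℝ n h Z)
    (hmap : ∀ x t, (x, t) ∈ U → m * x - l * t ∈ Z)
    (hu : ∀ x t, (x, t) ∈ U → u x t = h (m * x - l * t)) {i j : ℕ} (hij : i + j ≤ n) :
    ∀ x t, (x, t) ∈ U →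
      pd i j u x t = m ^ i * (-l) ^ j * iteratedDeriv (i + j) h (m * x - l * t) := by
  have hj : ∀ x t, (x, t) ∈ U → Dt^[j] u x t = (-l) ^ j * iteratedDeriv j h (m * x - l * t) := by
    have hjn : j ≤ n := by omega
    clear hij
    induction j with
    | zero => simpa using hu
    | succ j ih =>
      intro x t hx
      rw [Function.iterate_succ_apply', Dt_congr hU (ih (by omega)) x t hx]
      have hd : HasDerivAt (fun s => m * x - l * s) (-l) t := by
        simpa using ((hasDerivAt_id t).const_mul l).const_sub (m * x)
      refine (((hasDerivAt_iteratedDeriv hZ hh (by omega) (hmap x t hx)).comp t hd).const_mul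
        ((-l) ^ j)).deriv.trans ?_
      ring
  induction i with
  | zero => simpa [pd] using hj
  | succ i ih =>
    intro x t hx
    have e := Dx_congr hU (ih (by omega)) x t hx
    rw [pd, Function.iterate_succ_apply']
    refine e.trans ?_
    have hd : HasDerivAt (fun s => m * s - l * t) m x := by
      simpa using ((hasDerivAt_id x).const_mul m).sub_const (l * t)
    refine (((hasDerivAt_iteratedDeriv hZ hh (k := i + j) (by omega) (hmap x t hx)).comp x
      hd).const_mul (m ^ i * (-l) ^ j)).deriv.trans ?_
    rw [show i + 1 + j = i + j + 1 by omega]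
    ring

theorem mem_zRange {x t : ℝ} (hx : (x, t) ∈ U) : m * x - l * t ∈ zRange l m U := ⟨(x, t), hx, rfl⟩

theorem sq_add_sq_pos (hlm : l ≠ 0 ∨ m ≠ 0) : 0 < l ^ 2 + m ^ 2 := by
  rcases hlm with h | h <;> positivity

theorem isOpen_zRange (hlm : l ≠ 0 ∨ m ≠ 0) (hU : IsOpen U) : IsOpen (zRange l m U) := by
  have hN := (sq_add_sq_pos hlm).ne'
  set L : ℝ × ℝ →L[ℝ] ℝ := m • ContinuousLinearMap.fst ℝ ℝ ℝ - l • ContinuousLinearMap.snd ℝ ℝ ℝ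
  -- The preimage of z is taken along the gradient (m, -l) of the functional, scaled by its squared
  -- length l² + m².
  have hL : Function.Surjective L := fun z => by
    refine ⟨(z * m / (l ^ 2 + m ^ 2), -(z * l / (l ^ 2 + m ^ 2))), ?_⟩
    simp [L]
    field_simp
    ring
  have : zRange l m U = L '' U := by
    simp [zRange, L]
  rw [this]
  exact L.isOpenMap hL U hU

theorem isPreconnected_zRange (hU : Convex ℝ U) : IsPreconnected (zRange l m U) :=
  hU.isPreconnected.image _ (by fun_prop)

/-- On a connected open set, the second derivative vanishes iff the function is affine. -/
theorem second_deriv_eq_zero_iff {G G₁ G₂ : ℝ → ℝ} (hZ : IsOpen Z) (hZc : IsPreconnected Z)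
    (h1 : ∀ z ∈ Z, HasDerivAt G (G₁ z) z) (h2 : ∀ z ∈ Z, HasDerivAt G₁ (G₂ z) z) :
    (∀ z ∈ Z, G₂ z = 0) ↔ ∃ A B : ℝ, ∀ z ∈ Z, G z + A * z + B = 0 := by
  constructor
  · intro h0
    rcases Z.eq_empty_or_nonempty with rfl | ⟨w, hw⟩
    · exact ⟨0, 0, by simp⟩
    have e1 : ∀ z ∈ Z, G₁ z = G₁ w := fun z hz =>
      hZ.is_const_of_deriv_eq_zero hZc
        (fun y hy => (h2 y hy).differentiableAt.differentiableWithinAt)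
        (fun y hy => (h2 y hy).deriv.trans (h0 y hy)) hz hw
    have e2 : ∀ z ∈ Z, HasDerivAt (fun z => G z - z * G₁ w) 0 z := fun z hz => by
      have := (h1 z hz).sub ((hasDerivAt_id z).mul_const (G₁ w))
      rw [e1 z hz, one_mul, sub_self] at this
      exact this
    refine ⟨-G₁ w, w * G₁ w - G w, fun z hz => ?_⟩
    have e3 := hZ.is_const_of_deriv_eq_zero hZc
      (fun y hy => (e2 y hy).differentiableAt.differentiableWithinAt)
      (fun y hy => (e2 y hy).deriv) hz hw
    linear_combination e3
  · rintro ⟨A, B, hAB⟩ z hz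
    have e1 : ∀ y ∈ Z, G₁ y = -A := fun y hy => by
      have hev : G =ᶠ[nhds y] fun z => -A * z - B := by
        filter_upwards [hZ.mem_nhds hy] with s hs
        linear_combination hAB s hs
      rw [← (h1 y hy).deriv, hev.deriv_eq]
      simp
    have hev : G₁ =ᶠ[nhds z] fun _ => -A := by
      filter_upwards [hZ.mem_nhds hz] with s hs using e1 s hs
    rw [← (h2 z hz).deriv, hev.deriv_eq, deriv_const]

theorem isSolutionOn_wave_iff {c : ℝ} {f : ℝ → ℝ} {J : Set ℝ}
    (hf : ContDiffOn ℝ ∞ f J) (hlm : l ≠ 0 ∨ m ≠ 0) (hU : IsOpen U) (hUc : Convex ℝ U)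
    (hu : ContDiffOn ℝ 6 (fun p : ℝ × ℝ => u p.1 p.2) U) (huJ : ∀ x t, (x, t) ∈ U → u x t ∈ J)
    (hw : IsTravelingWave l m U u h) :
    IsSolutionOn c f J U u ↔ ∃ A B : ℝ, ProfileODE c f l m A B (zRange l m U) h := by
  have hZ := isOpen_zRange hlm hU
  have hh : ContDiffOn ℝ (6 : ℕ) h (zRange l m U) := hw.1
  have hφ : ContDiffOn ℝ (6 : ℕ) (fun z => f (h z)) (zRange l m U) := by
    refine (hf.of_le ENat.LEInfty.out).comp hh ?_
    rintro _ ⟨⟨x, t⟩, hx, rfl⟩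
    change h (m * x - l * t) ∈ J
    rw [← hw.2 x t hx]
    exact huJ x t hx
  have hmap : ∀ x t, (x, t) ∈ U → m * x - l * t ∈ zRange l m U := fun x t hx => mem_zRange hx
  have hpd : ∀ {i j : ℕ}, i + j ≤ 6 → ∀ x t, (x, t) ∈ U →
      pd i j u x t = m ^ i * (-l) ^ j * iteratedDeriv (i + j) h (m * x - l * t) :=
    fun hij => pd_wave hU hZ hh hmap hw.2 hij
  have hpf : ∀ x t, (x, t) ∈ U → pd 2 0 (fun y s => f (u y s)) x t
      = m ^ 2 * (-l) ^ 0 * iteratedDeriv 2 (fun z => f (h z)) (m * x - l * t) :=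
    pd_wave hU hZ hφ hmap (fun x t hx => by rw [hw.2 x t hx]) (by omega)
  -- `G k` is the k-th derivative of the profile expression without A z + B; of the six derivatives
  -- of h, four occur in `G 0` and the other two pay for `G 1` and `G 2`.
  set G : ℕ → ℝ → ℝ := fun k z => l ^ 2 * m ^ 4 * iteratedDeriv (4 + k) h z
    + m ^ 2 * (m ^ 2 * c - l ^ 2) * iteratedDeriv (2 + k) h z
    + (l ^ 2 - m ^ 2) * iteratedDeriv k h z - m ^ 2 * iteratedDeriv k (fun z => f (h z)) z with hG
  have hGd : ∀ k < 2, ∀ z ∈ zRange l m U, HasDerivAt (G k) (G (k + 1) z) z := fun k hk z hz =>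
    ((((hasDerivAt_iteratedDeriv hZ hh (by omega) hz).const_mul _).add
      ((hasDerivAt_iteratedDeriv hZ hh (by omega) hz).const_mul _)).add
      ((hasDerivAt_iteratedDeriv hZ hh (by omega) hz).const_mul _)).sub
      ((hasDerivAt_iteratedDeriv hZ hφ (by omega) hz).const_mul _)
  have hODE : (∃ A B : ℝ, ProfileODE c f l m A B (zRange l m U) h) ↔
      ∃ A B : ℝ, ∀ z ∈ zRange l m U, G 0 z + A * z + B = 0 := by
    simp [ProfileODE, hG]
  rw [hODE, ← second_deriv_eq_zero_iff hZ (isPreconnected_zRange hUc) (hGd 0 (by omega))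
    (hGd 1 (by omega))]
  -- Substituting the wave gives `G 2` itself, with no factor of l or m to divide out, so the cases
  -- l = 0 and m = 0 need no separate treatment.
  have key : ∀ x t, (x, t) ∈ U →
      (pd 0 2 u x t - pd 2 2 u x t + pd 4 2 u x t + c * pd 4 0 u x t - pd 2 0 u x t
        = pd 2 0 (fun y s => f (u y s)) x t ↔ G 2 (m * x - l * t) = 0) := fun x t hx => by
    rw [hpf x t hx, hpd (by omega) x t hx, hpd (by omega) x t hx, hpd (by omega) x t hx,
      hpd (by omega) x t hx, hpd (by omega) x t hx, ← sub_eq_zero]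
    simp only [hG, Nat.reduceAdd]
    ring_nf
  constructor
  · rintro ⟨-, hs⟩ _ ⟨⟨x, t⟩, hx, rfl⟩
    exact (key x t hx).1 (hs x t hx).2
  · exact fun h0 => ⟨hu, fun x t hx => ⟨huJ x t hx, (key x t hx).2 (h0 _ (hmap x t hx))⟩⟩

theorem hasFDerivAt_of_contDiffOn (hU : IsOpen U)
    (hu : ContDiffOn ℝ 6 (fun p : ℝ × ℝ => u p.1 p.2) U) {x t : ℝ} (hx : (x, t) ∈ U) :
    HasFDerivAt (fun p : ℝ × ℝ => u p.1 p.2) (Dx u x t • ContinuousLinearMap.fst ℝ ℝ ℝ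
      + Dt u x t • ContinuousLinearMap.snd ℝ ℝ ℝ) (x, t) := by
  have h := ((hu.contDiffAt (hU.mem_nhds hx)).differentiableAt (by simp)).hasFDerivAt
  have h1 : Dx u x t = fderiv ℝ (fun p : ℝ × ℝ => u p.1 p.2) (x, t) (1, 0) :=
    (HasFDerivAt.comp_hasDerivAt (f := fun s => (s, t)) (l := fun p : ℝ × ℝ => u p.1 p.2) x h
      ((hasDerivAt_id x).prodMk (hasDerivAt_const x t))).deriv
  have h2 : Dt u x t = fderiv ℝ (fun p : ℝ × ℝ => u p.1 p.2) (x, t) (0, 1) :=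
    (HasFDerivAt.comp_hasDerivAt (f := fun s => (x, s)) (l := fun p : ℝ × ℝ => u p.1 p.2) t h
      ((hasDerivAt_const t x).prodMk (hasDerivAt_id t))).deriv
  refine h.congr_fderiv ?_
  ext
  · simp [h1]
  · simp [h2]

/-- A function annihilated by `l ∂x + m ∂t` on a convex open set is a traveling wave. -/
theorem exists_isTravelingWave (hlm : l ≠ 0 ∨ m ≠ 0) (hU : IsOpen U) (hUc : Convex ℝ U)
    (hu : ContDiffOn ℝ 6 (fun p : ℝ × ℝ => u p.1 p.2) U)
    (h0 : ∀ x t, (x, t) ∈ U → l * Dx u x t + m * Dt u x t = 0) :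
    ∃ h : ℝ → ℝ, IsTravelingWave l m U u h := by
  have hN := (sq_add_sq_pos hlm).ne'
  have hconst : ∀ p ∈ U, ∀ q ∈ U, m * p.1 - l * p.2 = m * q.1 - l * q.2 →
      u p.1 p.2 = u q.1 q.2 := by
    intro p hp q hq hpq
    have hpq' : ∀ y ∈ U, Dx u y.1 y.2 * (q.1 - p.1) + Dt u y.1 y.2 * (q.2 - p.2) = 0 := by
      intro y hy
      -- Equal similarity variable makes q - p parallel to (l, m), so the derivative of u along the
      -- chord is a multiple of l u_x + m u_t = 0.
      have e : (l ^ 2 + m ^ 2) * (Dx u y.1 y.2 * (q.1 - p.1) + Dt u y.1 y.2 * (q.2 - p.2)) = 0 := by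
        linear_combination (l * (q.1 - p.1) + m * (q.2 - p.2)) * h0 _ _ hy
          + (l * Dt u y.1 y.2 - m * Dx u y.1 y.2) * hpq
      exact (mul_eq_zero.1 e).resolve_left hN
    have hcont : Continuous (AffineMap.lineMap p q : ℝ → ℝ × ℝ) := AffineMap.lineMap_continuous
    -- Parameters θ whose point on the line through p and q lies in `U`; convexity makes this an
    -- interval containing 0 and 1, so u agrees at p and q.
    set S : Set ℝ := (AffineMap.lineMap p q : ℝ →ᵃ[ℝ] ℝ × ℝ) ⁻¹' U with hS
    have hSo : IsOpen S := hU.preimage hcont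
    have hSc : IsPreconnected S := (hUc.affine_preimage _).isPreconnected
    have hd : ∀ θ ∈ S, HasDerivAt (fun θ : ℝ => (fun p : ℝ × ℝ => u p.1 p.2)
        (AffineMap.lineMap p q θ)) 0 θ := fun θ hθ => by
      have e1 := (hasFDerivAt_of_contDiffOn hU hu hθ).comp_hasDerivAt θ
        (AffineMap.hasDerivAt_lineMap (a := p) (b := q))
      exact e1.congr_deriv (by simpa [AffineMap.lineMap_apply] using hpq' _ hθ)
    have e := hSo.is_const_of_deriv_eq_zero hSc
      (fun θ hθ => (hd θ hθ).differentiableAt.differentiableWithinAt)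
      (fun θ hθ => (hd θ hθ).deriv) (x := 0) (y := 1) (by simpa [hS] using hp)
      (by simpa [hS] using hq)
    simpa using e
  classical
  -- The value at z is read off at an arbitrary point of the level set, which `hconst` makes
  -- harmless. The default 0 is used only outside the range.
  set h : ℝ → ℝ := fun z =>
    if hz : z ∈ zRange l m U then u hz.choose.1 hz.choose.2 else 0 with hh
  have hval : ∀ p ∈ U, u p.1 p.2 = h (m * p.1 - l * p.2) := by
    intro p hp
    have hz : m * p.1 - l * p.2 ∈ zRange l m U := ⟨p, hp, rfl⟩
    rw [hh]
    simp only [dif_pos hz]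
    exact hconst p hp _ hz.choose_spec.1 hz.choose_spec.2.symm
  refine ⟨h, ?_, fun x t hx => hval (x, t) hx⟩
  rintro _ ⟨⟨x, t⟩, hx, rfl⟩
  -- An affine section of the similarity variable: γ(z) moves from (x, t) in the direction (m, -l)
  -- and satisfies m γ₁ - l γ₂ = z. Near the base value h = u ∘ γ, so h inherits the regularity C⁶
  -- of u.
  set γ : ℝ → ℝ × ℝ := fun z => (x + (z - (m * x - l * t)) * m / (l ^ 2 + m ^ 2),
    t - (z - (m * x - l * t)) * l / (l ^ 2 + m ^ 2)) with hγ
  have hγ0 : γ (m * x - l * t) = (x, t) := by simp [hγ]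
  have hγc : ContDiff ℝ 6 γ := by
    simp only [hγ]
    fun_prop
  have hev : h =ᶠ[nhds (m * x - l * t)] fun z => (fun p : ℝ × ℝ => u p.1 p.2) (γ z) := by
    have hmem : U ∈ nhds (γ (m * x - l * t)) := by
      rw [hγ0]
      exact hU.mem_nhds hx
    filter_upwards [hγc.continuous.continuousAt.preimage_mem_nhds hmem] with z hz
    have := hval (γ z) hz
    rw [this]
    congr 1
    simp only [hγ]
    field_simp
    ring
  refine ContDiffAt.contDiffWithinAt (ContDiffAt.congr_of_eventuallyEq ?_ hev)
  refine ContDiffAt.comp (f := γ) (g := fun p : ℝ × ℝ => u p.1 p.2) _ ?_ hγc.contDiffAt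
  change ContDiffAt ℝ 6 (fun p : ℝ × ℝ => u p.1 p.2) (γ (m * x - l * t))
  rw [hγ0]
  exact hu.contDiffAt (hU.mem_nhds hx)

theorem VField.IsTranslation.reducesToTravelingWave {V : VField} {D : Set (ℝ × ℝ)} {J : Set ℝ}
    (hV : V.IsTranslation D J l m) (hlm : l ≠ 0 ∨ m ≠ 0) {c : ℝ} {f : ℝ → ℝ}
    (hf : ContDiffOn ℝ ∞ f J) : V.ReducesToTravelingWave c f D J l m := by
  intro U hU hUc hUD u hu huJ
  refine ⟨?_, fun h hw => isSolutionOn_wave_iff hf hlm hU hUc hu huJ hw⟩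
  have hchar : ∀ x t, (x, t) ∈ U →
      V.characteristic u x t = -(l * Dx u x t + m * Dt u x t) := fun x t hx => by
    obtain ⟨e1, e2, e3⟩ := hV x t (u x t) (hUD hx) (huJ x t hx)
    rw [VField.characteristic, e1, e2, e3]
    ring
  constructor
  · intro hI
    refine exists_isTravelingWave hlm hU hUc hu fun x t hx => ?_
    have := hI x t hx
    rw [hchar x t hx] at this
    linear_combination -this
  · rintro ⟨h, hw⟩ x t hx
    have hZ := isOpen_zRange hlm hU
    have hh : ContDiffOn ℝ (6 : ℕ) h (zRange l m U) := hw.1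
    have e1 : pd 1 0 u x t = _ :=
      pd_wave hU hZ hh (fun x t hx => mem_zRange hx) hw.2 (by omega) x t hx
    have e2 : pd 0 1 u x t = _ :=
      pd_wave hU hZ hh (fun x t hx => mem_zRange hx) hw.2 (by omega) x t hx
    simp only [pd, Function.iterate_zero, Function.iterate_one, id] at e1 e2
    rw [hchar x t hx, e1, e2]
    ring

theorem VField.IsTranslation.ne_zero {V : VField} {D : Set (ℝ × ℝ)} {J : Set ℝ}
    (hV : V.IsTranslation D J l m) (hn : V.Nontrivial D J) : l ≠ 0 ∨ m ≠ 0 := by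
  obtain ⟨x, t, u, hx, hu, hne⟩ := hn
  obtain ⟨e1, e2, e3⟩ := hV x t u hx hu
  rw [e1, e2, e3] at hne
  tauto

end

end Boussinesq

/-! ### Classification, reduction and action on solutions combined -/

theorem mainTheorem1 (c : ℝ) (D : Set (ℝ × ℝ)) (hDo : IsOpen D) (hDc : IsConnected D)
    (J : Set ℝ) (hJo : IsOpen J) (hJc : J.OrdConnected) :
    -- `c ≠ 0` and any one nonlinear `f`: the symmetries and the reductions
    (c ≠ 0 → ∀ f : ℝ → ℝ, Boussinesq.IsNonlinear f J →
      ∀ V : Boussinesq.VField, V.SmoothOn D J →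
        (V.IsLieSymmetry c f D J ↔ ∃ l m : ℝ, V.IsTranslation D J l m) ∧
        (V.IsLieSymmetry c f D J → V.Nontrivial D J →
          ∃ l m : ℝ, (l ≠ 0 ∨ m ≠ 0) ∧ V.IsTranslation D J l m ∧
            V.ReducesToTravelingWave c f D J l m)) ∧
    -- any `c`, with `f` left arbitrary: the symmetries common to all nonlinear `f`
    (∀ V : Boussinesq.VField, V.SmoothOn D J →
      ((∀ f : ℝ → ℝ, Boussinesq.IsNonlinear f J → V.IsLieSymmetry c f D J) ↔
        ∃ l m : ℝ, V.IsTranslation D J l m) ∧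
      ((∀ f : ℝ → ℝ, Boussinesq.IsNonlinear f J → V.IsLieSymmetry c f D J) → V.Nontrivial D J →
        ∃ l m : ℝ, (l ≠ 0 ∨ m ≠ 0) ∧ V.IsTranslation D J l m ∧
          ∀ f : ℝ → ℝ, Boussinesq.IsNonlinear f J → V.ReducesToTravelingWave c f D J l m)) ∧
    -- the translations act on solutions
    (∀ f : ℝ → ℝ, Boussinesq.IsNonlinear f J → ∀ (l m ε : ℝ) (U : Set (ℝ × ℝ)), IsOpen U →
      ∀ u : ℝ → ℝ → ℝ, Boussinesq.IsSolutionOn c f J U u →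
        Boussinesq.IsSolutionOn c f J {p | (p.1 - ε * l, p.2 - ε * m) ∈ U}
          (fun x t => u (x - ε * l) (t - ε * m))) := by
  refine ⟨fun hc f hf V hV => ⟨⟨fun h => ?_, fun ⟨l, m, h⟩ => h.isLieSymmetry hDo hJo c f⟩,
    fun h hn => ?_⟩, fun V hV => ⟨⟨fun h => ?_, fun ⟨l, m, h⟩ f _ => h.isLieSymmetry hDo hJo c f⟩,
    fun h hn => ?_⟩, fun f _ l m ε U _ u hu => hu.shift (ε * l) (ε * m)⟩
  · exact h.isTranslation_of_ne_zero hc hV hDo hDc hJo hJc hf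
  · obtain ⟨l, m, ht⟩ := h.isTranslation_of_ne_zero hc hV hDo hDc hJo hJc hf
    exact ⟨l, m, ht.ne_zero hn, ht, ht.reducesToTravelingWave (ht.ne_zero hn) hf.1⟩
  · exact Boussinesq.isTranslation_of_forall hV hDo hDc hJo hJc h
  · obtain ⟨l, m, ht⟩ := Boussinesq.isTranslation_of_forall hV hDo hDc hJo hJc h
    exact ⟨l, m, ht.ne_zero hn, ht, fun f hf =>
      ht.reducesToTravelingWave (ht.ne_zero hn) hf.1⟩
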